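/- Let $\mathbb{F}$ be a field of characteristic $0$ and let $K$ be a finite group. **Notation.** For a finite group $G$, let $\mathbb{F}B(G)=\mathbb{F}\otimes_{\mathbb Z}B(G)$, where $B(G)$ is the Grothendieck group of finite $G$-sets. A finite $(H,G)$-biset $U$ induces $\mathbb{F}B(U):\mathbb{F}B(G)\to\mathbb{F}B(H)$, $[X]\mapsto[U\times_GX]$. The shifted Burnside functor $\mathbb{F}B_K$ is given by $\mathbb{F}B_K(G)=\mathbb{F}B(G\times K)$ and $\mathbb{F}B_K(U)=\mathbb{F}B(U\times K)$, with products $\mathbb{F}B_K(G)\times\mathbb{F}B_K(H)\to\mathbb{F}B_K(G\times H)$ sending $([X],[Y])$ to the class of $X\times Y$, on which $(g,h,k)$ acts by $(x,y)\mapsto((g,k)x,(h,k)y)$. An ideal $I$ of $\mathbb{F}B_K$ is a family of subspaces $I(G)\subseteq\mathbb{F}B_K(G)$, for all finite groups $G$, stable under all maps $\mathbb{F}B_K(U)$ and such that the product of an element of $\mathbb{F}B_K(G)$ with an element of $I(H)$ lies in $I(G\times H)$. For a prime $p$, $\mathbb{F}B_K^{(p)}$ is the restriction of $\mathbb{F}B_K$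 to finite $p$-groups; its ideals are defined in the same way, using only finite $p$-groups. For a finite group $G$ and $L\leq G$, let $$e_L^G=\frac1{|N_G(L)|}\sum_{X\leq L}|X|\,\mu(X,L)\,[G/X]\in\mathbb{F}B(G),$$ where $\mu$ is the Möbius function of the poset of subgroups of $G$. For a normal subgroup $N$ of a finite group $L$, let $$m_{L,N}=\frac1{|L|}\sum_{X\leq L,\ XN=L}|X|\,\mu(X,L).$$ A group over $K$ is a pair $(L,\varphi)$ where $L$ is a finite group and $\varphi:L\to K$ is a group homomorphism. A morphism $f:(M,\psi)\to(L,\varphi)$ is a group homomorphism $f:M\to L$ such that $i\circ\psi=\varphi\circ f$ for some inner automorphism $i$ of $K$; it is called surjective if $f:M\to L$ is surjective. Let $\mathsf{e}_{L,\varphi}$ be the ideal of $\mathbb{F}B_K$ generated by $e_{L_\varphi}^{L\times K}\in\mathbb{F}B_K(L)$, where $L_\varphi=\{(l,\varphi(l))\mid l\in L\}$. For a prime $p$, the group $(L,\varphi)$ over $K$ is called $p$-persistent if $\mathsf{e}_{L,\varphi}(P)\neq\{0\}$ for some finite $p$-group $P$. Let $O^p(L)$ be the subgroup of $L$ generated by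 the elements of order prime to $p$, let $L^{[p]}=L/O^p(L)$ (a $p$-group), and let $\mathsf{e}^{(p)}_{L,\varphi}$ be the ideal of $\mathbb{F}B_K^{(p)}$ generated by $e_{L_\varphi^{(p)}}^{L^{[p]}\times K}\in\mathbb{F}B_K^{(p)}(L^{[p]})$, where $L_\varphi^{(p)}=\{(lO^p(L),\varphi(l))\mid l\in L\}$. **Theorem.** Let $s:(M,\psi)\to(L,\varphi)$ be a surjective morphism of groups over $K$. 1. If $m_{M,\operatorname{Ker}s}\neq0$, then $\mathsf{e}_{M,\psi}=\mathsf{e}_{L,\varphi}$. 2. Let $p$ be a prime, and assume that $(M,\psi)$ is $p$-persistent. Then $(L,\varphi)$ is $p$-persistent and $\mathsf{e}^{(p)}_{M,\psi}\subseteq\mathsf{e}^{(p)}_{L,\varphi}$. If moreover $m_{M,\operatorname{Ker}s}\neq0$, then $\mathsf{e}^{(p)}_{M,\psi}=\mathsf{e}^{(p)}_{L,\varphi}$. -/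

import Mathlib

open scoped TensorProduct Pointwise

universe u v

namespace RelativeBurnside

noncomputable section

/-! ## Finite `G`-sets and bisets -/

/-- A finite left `G`-set. -/
structure FinGSet (G : Type u) [Group G] : Type (u + 1) where
  carrier : Type u
  [mulAction : MulAction G carrier]
  [finite : Finite carrier]

attribute [instance] FinGSet.mulAction FinGSet.finite

/-- A finite `(H, G)`-biset: a finite set with a left `H`-action and a right `G`-action
(an action of `Gᵐᵒᵖ`) which commute. -/
structure FinBiset (H G : Type u) [Group H] [Group G] : Type (u + 1) where
  carrier : Type u
  [leftAction : MulAction H carrier]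
  [rightAction : MulAction Gᵐᵒᵖ carrier]
  [comm : SMulCommClass H Gᵐᵒᵖ carrier]
  [finite : Finite carrier]

attribute [instance] FinBiset.leftAction FinBiset.rightAction FinBiset.comm FinBiset.finite

namespace FinGSet

variable {G H : Type u} [Group G] [Group H]

/-- Isomorphism of `G`-sets. -/
def Iso (X Y : FinGSet G) : Prop :=
  ∃ e : X.carrier ≃ Y.carrier, ∀ (g : G) (x : X.carrier), e (g • x) = g • e x

instance isoSetoid (G : Type u) [Group G] : Setoid (FinGSet G) where
  r := Iso
  iseqv :=
    { refl := fun _ => ⟨Equiv.refl _, fun _ _ => rfl⟩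
      symm := fun ⟨e, he⟩ => ⟨e.symm, fun g y => by
        rw [Equiv.symm_apply_eq, he, Equiv.apply_symm_apply]⟩
      trans := fun ⟨e, he⟩ ⟨f, hf⟩ => ⟨e.trans f, fun g x => by simp [he, hf]⟩ }

/-- The empty `G`-set. -/
def empty (G : Type u) [Group G] : FinGSet G :=
  letI : MulAction G PEmpty.{u + 1} :=
    { smul := fun _ x => x, one_smul := fun _ => rfl, mul_smul := fun _ _ _ => rfl }
  { carrier := PEmpty.{u + 1} }

/-- Disjoint union of `G`-sets. -/
def sum (X Y : FinGSet G) : FinGSet G where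
  carrier := X.carrier ⊕ Y.carrier

/-- The transitive `G`-set `G / X`. -/
def quotient [Finite G] (X : Subgroup G) : FinGSet G where
  carrier := G ⧸ X

/-- Restriction of an `H`-set along a group homomorphism `f : G → H`. -/
def res (f : G →* H) (X : FinGSet H) : FinGSet G :=
  letI : MulAction G X.carrier := MulAction.compHom X.carrier f
  { carrier := X.carrier }

/-- The external product of a `G`-set and an `H`-set: the `(G × H)`-set `X × Y` with
`(g, h) • (x, y) = (g • x, h • y)`. -/
def extProd (X : FinGSet G) (Y : FinGSet H) : FinGSet (G × H) :=
  letI : MulAction (G × H) (X.carrier × Y.carrier) :=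
    { smul := fun a z => (a.1 • z.1, a.2 • z.2)
      one_smul := fun z => Prod.ext (one_smul G z.1) (one_smul H z.2)
      mul_smul := fun a b z => Prod.ext (mul_smul a.1 b.1 z.1) (mul_smul a.2 b.2 z.2) }
  { carrier := X.carrier × Y.carrier }

end FinGSet

namespace FinBiset

variable {H G : Type u} [Group H] [Group G]

/-- The equivalence relation on `U × X` whose quotient is `U ×_G X`: the orbit relation for
`(u, x) · g = (u g, g⁻¹ x)`. -/
def balancedSetoid (U : FinBiset H G) (X : FinGSet G) : Setoid (U.carrier × X.carrier) where
  r a b := ∃ g : G, b = (MulOpposite.op g • a.1, g⁻¹ • a.2)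
  iseqv :=
    { refl := fun a => ⟨1, by simp⟩
      symm := by
        rintro a b ⟨g, rfl⟩
        exact ⟨g⁻¹, by simp [smul_smul]⟩
      trans := by
        rintro a b c ⟨g, rfl⟩ ⟨h, rfl⟩
        exact ⟨g * h, by simp [smul_smul]⟩ }

/-- The `H`-action `h • [u, x] = [h • u, x]` on `U ×_G X`. -/
abbrev balancedAction (U : FinBiset H G) (X : FinGSet G) :
    MulAction H (Quotient (U.balancedSetoid X)) where
  smul h := Quotient.map (fun a => (h • a.1, a.2)) (by
    rintro a b ⟨g, rfl⟩
    exact ⟨g, Prod.ext (smul_comm _ _ _) rfl⟩)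
  one_smul := by
    rintro ⟨a⟩
    exact congrArg (Quotient.mk _) (Prod.ext (one_smul H a.1) rfl)
  mul_smul h k := by
    rintro ⟨a⟩
    exact congrArg (Quotient.mk _) (Prod.ext (mul_smul h k a.1) rfl)

/-- The `H`-set `U ×_G X`, for an `(H, G)`-biset `U` and a `G`-set `X`. -/
def balancedProd (U : FinBiset H G) (X : FinGSet G) : FinGSet H :=
  letI : MulAction H (Quotient (U.balancedSetoid X)) := U.balancedAction X
  { carrier := Quotient (U.balancedSetoid X) }

/-- The `(H × K, G × K)`-biset `U × K`, where `K` acts on both sides on the second component by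
multiplication. -/
def shift (K : Type u) [Group K] [Finite K] (U : FinBiset H G) : FinBiset (H × K) (G × K) :=
  letI : MulAction (H × K) (U.carrier × K) :=
    { smul := fun a z => (a.1 • z.1, a.2 * z.2)
      one_smul := fun z => Prod.ext (one_smul H z.1) (one_mul z.2)
      mul_smul := fun a b z => Prod.ext (mul_smul a.1 b.1 z.1) (mul_assoc a.2 b.2 z.2) }
  letI : MulAction (G × K)ᵐᵒᵖ (U.carrier × K) :=
    { smul := fun a z => (MulOpposite.op a.unop.1 • z.1, z.2 * a.unop.2)
      one_smul := fun z => Prod.ext (one_smul Gᵐᵒᵖ z.1) (mul_one z.2)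
      mul_smul := fun a b z => Prod.ext
        (mul_smul (MulOpposite.op a.unop.1) (MulOpposite.op b.unop.1) z.1)
        (mul_assoc z.2 b.unop.2 a.unop.2).symm }
  letI : SMulCommClass (H × K) (G × K)ᵐᵒᵖ (U.carrier × K) :=
    ⟨fun a b z => Prod.ext (smul_comm a.1 (MulOpposite.op b.unop.1) z.1)
      (mul_assoc a.2 z.2 b.unop.2).symm⟩
  { carrier := U.carrier × K }

end FinBiset

/-! ## The Burnside group -/

/-- Isomorphism classes of finite `G`-sets. -/
def IsoClass (G : Type u) [Group G] : Type (u + 1) := Quotient (FinGSet.isoSetoid G)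

namespace IsoClass

variable {G H : Type u} [Group G] [Group H]

/-- The isomorphism class of a finite `G`-set. -/
def mk (X : FinGSet G) : IsoClass G := Quotient.mk _ X

/-- Addition is given by disjoint union. -/
instance instAdd (G : Type u) [Group G] : Add (IsoClass G) where
  add := Quotient.map₂ FinGSet.sum (by
    rintro X X' ⟨e, he⟩ Y Y' ⟨f, hf⟩
    refine ⟨Equiv.sumCongr e f, fun g z => ?_⟩
    rcases z with x | y
    · exact congrArg Sum.inl (he g x)
    · exact congrArg Sum.inr (hf g y))

instance instZero (G : Type u) [Group G] : Zero (IsoClass G) where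
  zero := mk (FinGSet.empty G)

/-- Isomorphism classes form a commutative monoid under disjoint union. -/
instance instAddCommMonoid (G : Type u) [Group G] : AddCommMonoid (IsoClass G) where
  add_assoc := by
    rintro ⟨X⟩ ⟨Y⟩ ⟨Z⟩
    refine Quotient.sound ⟨Equiv.sumAssoc _ _ _, fun g z => ?_⟩
    rcases z with (x | y) | z <;> rfl
  zero_add := by
    rintro ⟨X⟩
    refine Quotient.sound ⟨Equiv.emptySum PEmpty.{u + 1} X.carrier, fun g z => ?_⟩
    rcases z with x | y
    · exact x.elim
    · rfl
  add_zero := by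
    rintro ⟨X⟩
    refine Quotient.sound ⟨Equiv.sumEmpty X.carrier PEmpty.{u + 1}, fun g z => ?_⟩
    rcases z with x | y
    · rfl
    · exact y.elim
  add_comm := by
    rintro ⟨X⟩ ⟨Y⟩
    refine Quotient.sound ⟨Equiv.sumComm _ _, fun g z => ?_⟩
    rcases z with x | y <;> rfl
  nsmul := nsmulRec

/-- Restriction on isomorphism classes. -/
def res (f : G →* H) : IsoClass H →+ IsoClass G where
  toFun := Quotient.map (FinGSet.res f) (by
    rintro X Y ⟨e, he⟩
    exact ⟨e, fun g x => he (f g) x⟩)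
  map_zero' := Quotient.sound ⟨Equiv.refl PEmpty.{u + 1}, fun _ x => x.elim⟩
  map_add' := by
    rintro ⟨X⟩ ⟨Y⟩
    refine Quotient.sound ⟨Equiv.refl (X.carrier ⊕ Y.carrier), fun g z => ?_⟩
    rcases z with x | y <;> rfl

/-- `[X] ↦ [U ×_G X]` on isomorphism classes. -/
def bisetMap (U : FinBiset H G) : IsoClass G →+ IsoClass H where
  toFun := Quotient.map U.balancedProd (by
    rintro X Y ⟨e, he⟩
    refine ⟨Quotient.congr (Equiv.prodCongr (Equiv.refl _) e) ?_, ?_⟩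
    · intro a b
      constructor
      · rintro ⟨g, rfl⟩
        exact ⟨g, Prod.ext rfl (he _ _)⟩
      · rintro ⟨g, hg⟩
        refine ⟨g, Prod.ext (congrArg Prod.fst hg :) (e.injective ?_)⟩
        exact (congrArg Prod.snd hg :).trans (he _ _).symm
    · rintro h ⟨a⟩
      rfl)
  map_zero' := by
    have h1 : IsEmpty (U.balancedProd (FinGSet.empty G)).carrier :=
      ⟨by rintro ⟨⟨_, x⟩⟩; exact (x : PEmpty.{u + 1}).elim⟩
    have h2 : IsEmpty (FinGSet.empty H).carrier := ⟨fun x => (x : PEmpty.{u + 1}).elim⟩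
    exact Quotient.sound ⟨Equiv.equivOfIsEmpty _ _, fun _ x => (h1.false x).elim⟩
  map_add' := by
    rintro ⟨X⟩ ⟨Y⟩
    refine Quotient.sound ⟨⟨Quotient.lift
        (fun a : U.carrier × (X.carrier ⊕ Y.carrier) =>
          (Sum.elim (fun x => Sum.inl (Quotient.mk (U.balancedSetoid X) (a.1, x)))
            (fun y => Sum.inr (Quotient.mk (U.balancedSetoid Y) (a.1, y))) a.2 :
            Quotient (U.balancedSetoid X) ⊕ Quotient (U.balancedSetoid Y))) ?_,
      Sum.elim
        (Quotient.lift (fun a => Quotient.mk (U.balancedSetoid (X.sum Y)) (a.1, Sum.inl a.2)) ?_)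
        (Quotient.lift (fun a => Quotient.mk (U.balancedSetoid (X.sum Y)) (a.1, Sum.inr a.2)) ?_),
      ?_, ?_⟩, ?_⟩
    · rintro ⟨w, x | y⟩ b ⟨g, rfl⟩
      · exact congrArg Sum.inl (Quotient.sound ⟨g, rfl⟩)
      · exact congrArg Sum.inr (Quotient.sound ⟨g, rfl⟩)
    · rintro a b ⟨g, rfl⟩
      exact Quotient.sound ⟨g, rfl⟩
    · rintro a b ⟨g, rfl⟩
      exact Quotient.sound ⟨g, rfl⟩
    · rintro ⟨w, x | y⟩ <;> rfl
    · rintro (⟨⟨w, x⟩⟩ | ⟨⟨w, y⟩⟩) <;> rfl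
    · rintro h ⟨w, x | y⟩ <;> rfl

/-- The external product `([X], [Y]) ↦ [X × Y]` on isomorphism classes. -/
def extProd : IsoClass G →+ IsoClass H →+ IsoClass (G × H) where
  toFun a :=
    { toFun := fun b => Quotient.map₂ FinGSet.extProd (by
        rintro X X' ⟨e, he⟩ Y Y' ⟨f, hf⟩
        exact ⟨Equiv.prodCongr e f, fun g z => Prod.ext (he g.1 z.1) (hf g.2 z.2)⟩) a b
      map_zero' := by
        induction a using Quotient.inductionOn with | _ X => ?_
        exact Quotient.sound ⟨Equiv.prodPEmpty X.carrier,
          fun _ z => (z.2 : PEmpty.{u + 1}).elim⟩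
      map_add' := by
        induction a using Quotient.inductionOn with | _ X => ?_
        rintro ⟨Y⟩ ⟨Z⟩
        refine Quotient.sound ⟨Equiv.prodSumDistrib _ _ _, ?_⟩
        rintro g ⟨x, y | z⟩ <;> rfl }
  map_zero' := by
    ext ⟨Y⟩
    exact Quotient.sound ⟨Equiv.pemptyProd Y.carrier,
      fun _ z => (z.1 : PEmpty.{u + 1}).elim⟩
  map_add' := by
    rintro ⟨X⟩ ⟨Y⟩
    ext ⟨Z⟩
    refine Quotient.sound ⟨Equiv.sumProdDistrib _ _ _, ?_⟩
    rintro g ⟨x | y, z⟩ <;> rfl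

end IsoClass

/-- The Burnside group `B(G)`: the Grothendieck group of finite `G`-sets. -/
abbrev BurnsideGroup (G : Type u) [Group G] : Type (u + 1) :=
  Algebra.GrothendieckAddGroup (IsoClass G)

/-- `𝔽B(G) = 𝔽 ⊗_ℤ B(G)`. -/
abbrev FB (F : Type v) [Field F] (G : Type u) [Group G] : Type (max v (u + 1)) :=
  F ⊗[ℤ] BurnsideGroup G

namespace FB

variable (F : Type v) [Field F]

/-- The class `[X] ∈ 𝔽B(G)` of a finite `G`-set. -/
def cls {G : Type u} [Group G] (X : FinGSet G) : FB F G :=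
  (1 : F) ⊗ₜ[ℤ] (Algebra.GrothendieckAddGroup.of (IsoClass.mk X) : BurnsideGroup G)

/-- An additive map from isomorphism classes of finite `G`-sets to an `𝔽`-vector space extends
uniquely to an `𝔽`-linear map on `𝔽B(G)`. -/
def lift {G : Type u} [Group G] {V : Type*} [AddCommGroup V] [Module F V]
    (f : IsoClass G →+ V) : FB F G →ₗ[F] V :=
  LinearMap.liftBaseChange F (Algebra.GrothendieckAddGroup.lift f).toIntLinearMap

theorem hom_ext {G : Type u} [Group G] {V : Type*} [AddCommGroup V] [Module F V]
    {f g : FB F G →ₗ[F] V} (h : ∀ X : FinGSet G, f (cls F X) = g (cls F X)) : f = g := by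
  refine TensorProduct.AlgebraTensorModule.curry_injective ?_
  refine LinearMap.ext_ring (LinearMap.toAddMonoidHom_injective ?_)
  refine Algebra.GrothendieckAddGroup.lift.symm.injective ?_
  ext ⟨X⟩
  exact h X

/-- The inclusion of isomorphism classes in `𝔽B(G)`. -/
def ι (G : Type u) [Group G] : IsoClass G →+ FB F G :=
  ((TensorProduct.mk ℤ F (BurnsideGroup G) 1).toAddMonoidHom).comp Algebra.GrothendieckAddGroup.of

theorem ι_mk {G : Type u} [Group G] (X : FinGSet G) : ι F G (IsoClass.mk X) = cls F X := rfl

theorem lift_cls {G : Type u} [Group G] {V : Type*} [AddCommGroup V] [Module F V]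
    (f : IsoClass G →+ V) (X : FinGSet G) : lift F f (cls F X) = f (IsoClass.mk X) := by
  simp only [lift, cls, LinearMap.liftBaseChange_tmul, one_smul]
  exact DFunLike.congr_fun (Algebra.GrothendieckAddGroup.lift.symm_apply_apply f) (IsoClass.mk X)

/-- Restriction `𝔽B(H) → 𝔽B(G)` along a group homomorphism `f : G → H`. -/
def res {G H : Type u} [Group G] [Group H] (f : G →* H) : FB F H →ₗ[F] FB F G :=
  lift F ((ι F G).comp (IsoClass.res f))

/-- The map `𝔽B(U) : 𝔽B(G) → 𝔽B(H)` induced by a finite `(H, G)`-biset `U`,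
sending `[X]` to `[U ×_G X]`. -/
def bisetMap {G H : Type u} [Group G] [Group H] (U : FinBiset H G) : FB F G →ₗ[F] FB F H :=
  lift F ((ι F H).comp (IsoClass.bisetMap U))

/-- The bilinear product `𝔽B(G) × 𝔽B(H) → 𝔽B(G × H)`, sending `([X], [Y])` to `[X × Y]`. -/
def extProd (G H : Type u) [Group G] [Group H] : FB F G →ₗ[F] FB F H →ₗ[F] FB F (G × H) :=
  lift F
    { toFun := fun a => lift F ((ι F (G × H)).comp (IsoClass.extProd a))
      map_zero' := by
        refine hom_ext F fun X => ?_
        simp [lift_cls]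
      map_add' := fun a b => by
        refine hom_ext F fun X => ?_
        simp [lift_cls] }

end FB

/-! ## The shifted Burnside functor and its ideals -/

/-- `𝔽B_K(G) = 𝔽B(G × K)`. -/
abbrev FBK (F : Type v) [Field F] (K : Type u) [Group K] (G : Type u) [Group G] :
    Type (max v (u + 1)) :=
  FB F (G × K)

namespace FBK

variable (F : Type v) [Field F] (K : Type u) [Group K]

/-- The map `𝔽B_K(U) = 𝔽B(U × K) : 𝔽B_K(G) → 𝔽B_K(H)` for a finite `(H, G)`-biset `U`. -/
def bisetMap [Finite K] {G H : Type u} [Group G] [Group H] (U : FinBiset H G) :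
    FBK F K G →ₗ[F] FBK F K H :=
  FB.bisetMap F (U.shift K)

/-- The homomorphism `((g, h), k) ↦ ((g, k), (h, k))`. It is an isomorphism from `(G × H) × K` to
the subgroup `Δ = {(g, k, h, k)}` of `(G × K) × (H × K)`, followed by the inclusion of `Δ`. -/
def diag (G H : Type u) [Group G] [Group H] : (G × H) × K →* (G × K) × (H × K) where
  toFun x := ((x.1.1, x.2), (x.1.2, x.2))
  map_one' := rfl
  map_mul' _ _ := rfl

/-- The product `𝔽B_K(G) × 𝔽B_K(H) → 𝔽B_K(G × H)` of the shifted functor: the external product in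
`𝔽B((G × K) × (H × K))`, restricted to `Δ ≅ (G × H) × K`. -/
def prod (G H : Type u) [Group G] [Group H] :
    FBK F K G →ₗ[F] FBK F K H →ₗ[F] FBK F K (G × H) :=
  (FB.extProd F (G × K) (H × K)).compr₂ (FB.res F (diag K G H))

end FBK

/-- Let `𝒟` be a class of finite groups. An ideal of the restriction of the Green biset functor
`𝔽B_K` to `𝒟` is a family of `𝔽`-subspaces `I(G) ⊆ 𝔽B_K(G)`, for `G` in `𝒟`, stable under the maps
induced by bisets (hence by their `𝔽`-linear combinations) and under the products
`𝔽B_K(G) × I(H) → I(G × H)`. As `𝔽B_K` is commutative, there is no difference between left ideals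
and two-sided ideals. -/
@[ext]
structure GreenIdeal (F : Type v) [Field F] (K : Type u) [Group K] [Finite K]
    (𝒟 : ∀ (G : Type u) [Group G], Prop) where
  carrier : ∀ (G : Type u) [Group G] [Finite G], 𝒟 G → Submodule F (FBK F K G)
  bisetMap_mem : ∀ {G H : Type u} [Group G] [Finite G] [Group H] [Finite H] (hG : 𝒟 G) (hH : 𝒟 H)
    (U : FinBiset H G) (a : FBK F K G), a ∈ carrier G hG →
      FBK.bisetMap F K U a ∈ carrier H hH
  prod_mem : ∀ {G H : Type u} [Group G] [Finite G] [Group H] [Finite H] (_ : 𝒟 G) (hH : 𝒟 H)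
    (hGH : 𝒟 (G × H)) (a : FBK F K G) (b : FBK F K H), b ∈ carrier H hH →
      FBK.prod F K G H a b ∈ carrier (G × H) hGH

namespace GreenIdeal

variable {F : Type v} [Field F] {K : Type u} [Group K] [Finite K]
  {𝒟 : ∀ (G : Type u) [Group G], Prop}

/-- Ideals are ordered by inclusion. -/
instance : PartialOrder (GreenIdeal F K 𝒟) where
  le I J := ∀ (G : Type u) [Group G] [Finite G] (hG : 𝒟 G), I.carrier G hG ≤ J.carrier G hG
  le_refl _ _ _ _ _ := le_rfl
  le_trans _ _ _ h₁ h₂ G _ _ hG := (h₁ G hG).trans (h₂ G hG)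
  le_antisymm I J h₁ h₂ := by
    ext G _ _ hG x
    exact ⟨fun h => h₁ G hG h, fun h => h₂ G hG h⟩

/-- The ideal generated by an element `a ∈ 𝔽B_K(G₀)`: the intersection of all the ideals `I` with
`a ∈ I(G₀)`. -/
def span {G₀ : Type u} [Group G₀] [Finite G₀] (h₀ : 𝒟 G₀) (a : FBK F K G₀) :
    GreenIdeal F K 𝒟 where
  carrier G _ _ hG := ⨅ (I : GreenIdeal F K 𝒟) (_ : a ∈ I.carrier G₀ h₀), I.carrier G hG
  bisetMap_mem := by
    intro G H _ _ _ _ hG hH U x hx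
    simp only [Submodule.mem_iInf] at hx ⊢
    exact fun I hI => I.bisetMap_mem hG hH U x (hx I hI)
  prod_mem := by
    intro G H _ _ _ _ hG hH hGH x y hy
    simp only [Submodule.mem_iInf] at hy ⊢
    exact fun I hI => I.prod_mem hG hH hGH x y (hy I hI)

theorem mem_span_self {G₀ : Type u} [Group G₀] [Finite G₀] (h₀ : 𝒟 G₀) (a : FBK F K G₀) :
    a ∈ (span h₀ a).carrier G₀ h₀ := by
  simp only [span, Submodule.mem_iInf]
  exact fun I hI => hI

theorem span_le {G₀ : Type u} [Group G₀] [Finite G₀] (h₀ : 𝒟 G₀) (a : FBK F K G₀)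
    (I : GreenIdeal F K 𝒟) : span h₀ a ≤ I ↔ a ∈ I.carrier G₀ h₀ :=
  ⟨fun h => h G₀ h₀ (mem_span_self h₀ a),
    fun h _ _ _ _ => iInf₂_le (f := fun (J : GreenIdeal F K 𝒟) _ => J.carrier _ _) I h⟩

end GreenIdeal

/-! ## Möbius function, idempotents and the constants `m_{L,N}` -/

/-- The Möbius function of the poset of subgroups of the finite group `G`. -/
def subgroupMu (G : Type u) [Group G] [Finite G] (X Y : Subgroup G) : ℤ :=
  letI : Fintype (Subgroup G) := Fintype.ofFinite _
  letI : DecidableEq (Subgroup G) := Classical.decEq _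
  letI : DecidableLE (Subgroup G) := Classical.decRel _
  letI : DecidableLT (Subgroup G) := Classical.decRel _
  letI : LocallyFiniteOrder (Subgroup G) := Fintype.toLocallyFiniteOrder
  IncidenceAlgebra.mu ℤ X Y

/-- The primitive idempotent of `𝔽B(G)` attached to the subgroup `L` of `G` (Gluck's formula):
`e_L^G = 1/|N_G(L)| ∑_{X ≤ L} |X| μ(X, L) [G/X]`. -/
def idem (F : Type v) [Field F] {G : Type u} [Group G] [Finite G] (L : Subgroup G) : FB F G :=
  (Nat.card (Subgroup.normalizer (L : Set G)) : F)⁻¹ •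
    ∑ᶠ (X : Subgroup G) (_ : X ≤ L),
      ((Nat.card X : F) * (subgroupMu G X L : F)) • FB.cls F (FinGSet.quotient X)

/-- `m_{L,N} = 1/|L| ∑_{X ≤ L, XN = L} |X| μ(X, L)`, for `N` normal in `L`. -/
def mConst (L : Type u) [Group L] [Finite L] (N : Subgroup L) [N.Normal] : ℚ :=
  (Nat.card L : ℚ)⁻¹ *
    ∑ᶠ (X : Subgroup L) (_ : (X : Set L) * (N : Set L) = Set.univ),
      (Nat.card X : ℚ) * (subgroupMu L X ⊤ : ℚ)

/-! ## Groups over `K` -/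

/-- A finite group over `K`: a pair `(L, φ)` with `L` a finite group and `φ : L → K`. -/
structure GrpOver (K : Type u) [Group K] : Type (u + 1) where
  carrier : Type u
  [group : Group carrier]
  [finite : Finite carrier]
  hom : carrier →* K

attribute [instance] GrpOver.group GrpOver.finite

namespace GrpOver

variable {K : Type u} [Group K]

/-- A morphism `(M, ψ) → (L, φ)`: a group homomorphism `f : M → L` with `i ∘ ψ = φ ∘ f` for some
inner automorphism `i` of `K`. -/
@[ext]
structure Hom (M L : GrpOver K) where
  toMonoidHom : M.carrier →* L.carrier
  exists_inner : ∃ k : K,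
    (MulAut.conj k).toMonoidHom.comp M.hom = L.hom.comp toMonoidHom

instance : CategoryTheory.Category (GrpOver K) where
  Hom := Hom
  id M := ⟨MonoidHom.id _, 1, by ext; simp⟩
  comp f g := ⟨g.toMonoidHom.comp f.toMonoidHom, by
    obtain ⟨k, hk⟩ := f.exists_inner
    obtain ⟨l, hl⟩ := g.exists_inner
    refine ⟨l * k, MonoidHom.ext fun m => ?_⟩
    have h1 := DFunLike.congr_fun hk m
    have h2 := DFunLike.congr_fun hl (f.toMonoidHom m)
    simp only [MonoidHom.comp_apply, MulEquiv.toMonoidHom_eq_coe, MonoidHom.coe_coe,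
      map_mul, MulAut.mul_apply] at h1 h2 ⊢
    rw [h1, h2]⟩

end GrpOver

/-! ## The ideals attached to groups over `K` -/

section Ideals

variable (F : Type v) [Field F] {K : Type u} [Group K] [Finite K]

/-- The ideal `𝖾_{L,φ}` of `𝔽B_K` generated by `e_{L_φ}^{L × K}`, where
`L_φ = {(l, φ l)} ≤ L × K` is the graph of `φ`. -/
def eIdeal (L : GrpOver K) : GreenIdeal F K (fun _ _ => True) :=
  GreenIdeal.span (G₀ := L.carrier) trivial (idem F L.hom.graph)

/-- `(L, φ)` is `p`-persistent if `𝖾_{L,φ}(P) ≠ {0}` for some finite `p`-group `P`. -/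
def IsPersistent (p : ℕ) (L : GrpOver K) : Prop :=
  ∃ (P : Type u) (_ : Group P) (_ : Finite P),
    IsPGroup p P ∧ (eIdeal F L).carrier P trivial ≠ ⊥

/-- `O^p(L)`: the subgroup generated by the `p'`-elements. -/
def Op (p : ℕ) (L : Type u) [Group L] : Subgroup L :=
  Subgroup.closure {x : L | ¬ p ∣ orderOf x}

instance Op_normal (p : ℕ) (L : Type u) [Group L] : (Op p L).Normal := by
  suffices h : ∀ g : L, ∀ x ∈ {x : L | ¬ p ∣ orderOf x}, g * x * g⁻¹ ∈
      {x : L | ¬ p ∣ orderOf x} by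
    refine ⟨fun n hn g => ?_⟩
    induction hn using Subgroup.closure_induction with
    | mem x hx => exact Subgroup.subset_closure (h g x hx)
    | one => simp
    | mul x y _ _ hx hy => simpa [mul_assoc] using Subgroup.mul_mem _ hx hy
    | inv x _ hx => simpa [mul_assoc] using Subgroup.inv_mem _ hx
  intro g x hx
  have h : orderOf (g * x * g⁻¹) = orderOf x := by
    have := orderOf_injective (MulAut.conj g).toMonoidHom (MulAut.conj g).injective x
    simpa using this
  simpa [h] using hx

/-- `L^{[p]} = L / O^p(L)`. -/
abbrev pQuot (p : ℕ) (L : Type u) [Group L] : Type u := L ⧸ Op p L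

theorem isPGroup_pQuot (p : ℕ) [hp : Fact p.Prime] (L : Type u) [Group L] [Finite L] :
    IsPGroup p (pQuot p L) := by
  intro x
  obtain ⟨x, rfl⟩ := QuotientGroup.mk_surjective x
  obtain ⟨a, m, hm, h⟩ := Nat.exists_eq_pow_mul_and_not_dvd (orderOf_pos x).ne' p hp.out.ne_one
  refine ⟨a, ?_⟩
  rw [← QuotientGroup.mk_pow, QuotientGroup.eq_one_iff]
  refine Subgroup.subset_closure ?_
  have h2 : orderOf (x ^ p ^ a) = m := by
    rw [orderOf_pow_of_dvd (pow_pos hp.out.pos a).ne' (h ▸ Dvd.intro _ rfl), h,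
      Nat.mul_div_cancel_left _ (pow_pos hp.out.pos a)]
  simpa [h2] using hm

/-- `L^{(p)}_φ = {(l O^p(L), φ l)} ≤ L^{[p]} × K`. -/
def pGraph (p : ℕ) (L : GrpOver K) : Subgroup (pQuot p L.carrier × K) :=
  ((QuotientGroup.mk' (Op p L.carrier)).prod L.hom).range

/-- The ideal `𝖾^{(p)}_{L,φ}` of `𝔽B_K^{(p)}`, the restriction of `𝔽B_K` to finite `p`-groups,
generated by `e_{L^{(p)}_φ}^{L^{[p]} × K}`. -/
def eIdealP (p : ℕ) [Fact p.Prime] (L : GrpOver K) :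
    GreenIdeal F K (fun G _ => IsPGroup p G) :=
  GreenIdeal.span (G₀ := pQuot p L.carrier) (isPGroup_pQuot p L.carrier) (idem F (pGraph p L))

end Ideals

end

end RelativeBurnside

open RelativeBurnside

namespace RelativeBurnside

noncomputable section

open scoped Classical

attribute [local instance] Fintype.ofFinite

/-! ## The Möbius function of the subgroup lattice -/

section Subgroups

variable {G Q : Type u} [Group G] [Group Q]

/-! In characteristic zero an element of a Burnside algebra is determined by its marks
(`FB.eq_of_mark_eq`), and `idem F X` has nonzero marks exactly at the conjugates of `X`. Ideals
absorb the internal product, for which e_X · y is the mark of y at X times e_X. Hence an ideal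
contains e_X as soon as one of its elements has a nonzero mark at X
(`GreenIdeal.idem_mem_of_mark_ne_zero`).

Pulling back along s × K turns a mark at X into a mark at the image of X. The image of the graph of
ψ is conjugate to the graph of φ, so the ideal of M lies in that of L. Pushing e_X forward along s ×
K, its mark at the image of X is a nonzero scalar times the constant m of the kernel on X; this
gives the reverse inclusion when m_{M, Ker s} ≠ 0. Both arguments apply to the p-graphs.

For p-graphs the relevant constant is recovered from multiplicativity, m_{G, q⁻¹(N)} = m_{G, Ker q}
· m_{Q, N} (`mConst_comap`): factoring through M → L reduces it to m_{M, Ker s} ≠ 0 and m_{L, R} ≠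
0, with R = O^p(L) ∩ Ker φ. Persistence yields the latter. The forms A ↦ |(S \ A)^T|, for groups T
over G × K and S containing O^p(T) ∩ Ker(T → K), have as common kernel an ideal that vanishes on
p-groups. If L is persistent, one of these forms is nonzero on e_{L_φ}; expanding it gives m_{L,N} ≠
0 for some normal N ≥ R, and multiplicativity descends from N to R. -/

theorem card_map_mul_card_inf_ker (q : G →* Q) (X : Subgroup G) :
    Nat.card (X.map q) * Nat.card (X ⊓ q.ker : Subgroup G) = Nat.card X := by
  rw [← Subgroup.relIndex_ker, ← Subgroup.inf_relIndex_left, mul_comm,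
    ← Subgroup.relIndex_bot_left, ← Subgroup.relIndex_bot_left]
  exact Subgroup.relIndex_mul_relIndex _ _ _ bot_le inf_le_left

theorem map_inf_comap (q : G →* Q) (X : Subgroup G) (A : Subgroup Q) :
    (X ⊓ A.comap q).map q = X.map q ⊓ A := by
  ext y
  simp only [Subgroup.mem_map, Subgroup.mem_inf, Subgroup.mem_comap]
  constructor
  · rintro ⟨x, ⟨h1, h2⟩, rfl⟩
    exact ⟨⟨x, h1, rfl⟩, h2⟩
  · rintro ⟨⟨x, h1, rfl⟩, h2⟩
    exact ⟨x, ⟨h1, h2⟩, rfl⟩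

theorem sup_comap_eq_top_iff (q : G →* Q) (hq : Function.Surjective q) (X : Subgroup G)
    (N : Subgroup Q) : X ⊔ N.comap q = ⊤ ↔ X.map q ⊔ N = ⊤ := by
  have h1 : q.ker ≤ X ⊔ N.comap q := (Subgroup.ker_le_comap q N).trans le_sup_right
  rw [← (Subgroup.comap_injective hq).eq_iff, Subgroup.comap_top]
  nth_rw 2 [← Subgroup.map_comap_eq_self_of_surjective hq N]
  rw [← Subgroup.map_sup, Subgroup.comap_map_eq_self h1]

end Subgroups

section Moebius

variable {G Q : Type u} [Group G] [Finite G] [Group Q] [Finite Q]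

theorem subgroupMu_of_not_le {X Y : Subgroup G} (h : ¬ X ≤ Y) : subgroupMu G X Y = 0 :=
  IncidenceAlgebra.apply_eq_zero_of_not_le h _

theorem sum_subgroupMu_left (A B : Subgroup G) :
    (∑ X : Subgroup G, if A ≤ X then subgroupMu G X B else 0) = if A = B then 1 else 0 := by
  let _ : DecidableEq (Subgroup G) := Classical.decEq _
  let _ : DecidableLE (Subgroup G) := Classical.decRel _
  let _ : DecidableLT (Subgroup G) := Classical.decRel _
  let _ : LocallyFiniteOrder (Subgroup G) := Fintype.toLocallyFiniteOrder
  have h := IncidenceAlgebra.sum_Icc_mu_left (𝕜 := ℤ) A B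
  have h2 : (∑ X ∈ Finset.Icc A B, subgroupMu G X B) = if A = B then 1 else 0 := by
    convert h
    rfl
  rw [← h2, ← Finset.sum_filter]
  symm
  refine Finset.sum_subset (fun X hX => by simpa using (Finset.mem_Icc.1 hX).1) fun X hX hX2 => ?_
  refine subgroupMu_of_not_le fun h3 => hX2 (Finset.mem_Icc.2 ⟨by simpa using hX, h3⟩)

theorem sum_subgroupMu_right (A B : Subgroup G) :
    (∑ X : Subgroup G, if X ≤ B then subgroupMu G A X else 0) = if A = B then 1 else 0 := by
  let _ : DecidableEq (Subgroup G) := Classical.decEq _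
  let _ : DecidableLE (Subgroup G) := Classical.decRel _
  let _ : DecidableLT (Subgroup G) := Classical.decRel _
  let _ : LocallyFiniteOrder (Subgroup G) := Fintype.toLocallyFiniteOrder
  have h := IncidenceAlgebra.sum_Icc_mu_right (𝕜 := ℤ) A B
  have h2 : (∑ X ∈ Finset.Icc A B, subgroupMu G A X) = if A = B then 1 else 0 := by
    convert h
    rfl
  rw [← h2, ← Finset.sum_filter]
  symm
  refine Finset.sum_subset (fun X hX => by simpa using (Finset.mem_Icc.1 hX).2) fun X hX hX2 => ?_
  refine subgroupMu_of_not_le fun h3 => hX2 (Finset.mem_Icc.2 ⟨h3, by simpa using hX⟩)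

theorem sum_cast_subgroupMu_left (F : Type*) [CommRing F] (A B : Subgroup G) :
    (∑ X : Subgroup G, if A ≤ X then (subgroupMu G X B : F) else 0) = if A = B then 1 else 0 := by
  have h := congrArg (Int.cast : ℤ → F) (sum_subgroupMu_left A B)
  push_cast at h
  exact h

theorem sum_cast_subgroupMu_right (F : Type*) [CommRing F] (A B : Subgroup G) :
    (∑ X : Subgroup G, if X ≤ B then (subgroupMu G A X : F) else 0) = if A = B then 1 else 0 := by
  have h := congrArg (Int.cast : ℤ → F) (sum_subgroupMu_right A B)
  push_cast at h
  exact h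

/-- Möbius inversion: the sums over the subgroups above A determine f. -/
theorem eq_mul_subgroupMu_of_sum_eq {R : Type*} [CommRing R] (f : Subgroup G → R) (C : R)
    (B : Subgroup G) (h : ∀ A, (∑ X, if A ≤ X then f X else 0) = if A = B then C else 0)
    (A : Subgroup G) : f A = C * subgroupMu G A B := by
  calc f A = ∑ X, (if A = X then 1 else 0) * f X := by simp
    _ = ∑ X, ∑ Y, (if Y ≤ X then (subgroupMu G A Y : R) else 0) * f X := by
      simp_rw [← sum_cast_subgroupMu_right R, Finset.sum_mul]
    _ = ∑ Y, (subgroupMu G A Y : R) * ∑ X, if Y ≤ X then f X else 0 := by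
      rw [Finset.sum_comm]
      simp [Finset.mul_sum]
    _ = C * subgroupMu G A B := by simp [h, mul_comm]

theorem eq_subgroupMu_of_sum_eq (f : Subgroup G → ℤ) (B : Subgroup G)
    (h : ∀ A, (∑ X, if A ≤ X then f X else 0) = if A = B then 1 else 0) (A : Subgroup G) :
    f A = subgroupMu G A B := by
  simpa using eq_mul_subgroupMu_of_sum_eq f 1 B h A

theorem sum_map_of_injective {R : Type*} [AddCommMonoid R] (j : Q →* G)
    (hj : Function.Injective j) (f : Subgroup G → R) :
    ∑ A : Subgroup Q, f (A.map j) = ∑ X : Subgroup G, if X ≤ j.range then f X else 0 := by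
  rw [← Finset.sum_filter]
  refine Finset.sum_bij (fun A _ => A.map j) ?_ ?_ ?_ ?_
  · intro A _
    simpa using Subgroup.map_le_range j A
  · intro A _ B _ h
    exact Subgroup.map_injective hj h
  · intro X hX
    exact ⟨X.comap j, Finset.mem_univ _, Subgroup.map_comap_eq_self (by simpa using hX)⟩
  · simp

theorem subgroupMu_map_range (j : Q →* G) (hj : Function.Injective j) (A : Subgroup Q) :
    subgroupMu G (A.map j) j.range = subgroupMu Q A ⊤ := by
  refine eq_subgroupMu_of_sum_eq (fun A => subgroupMu G (A.map j) j.range) ⊤ (fun A => ?_) A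
  have h1 := sum_map_of_injective j hj
    (fun X => if A.map j ≤ X then subgroupMu G X j.range else 0)
  simp_rw [Subgroup.map_le_map_iff_of_injective hj] at h1
  rw [h1]
  have h2 := sum_subgroupMu_left (A.map j) j.range
  have h3 : (A.map j = j.range) = (A = ⊤) := by
    rw [MonoidHom.range_eq_map]
    exact propext (Subgroup.map_injective hj).eq_iff
  rw [h3] at h2
  rw [← h2]
  refine Finset.sum_congr rfl fun X _ => ?_
  by_cases hX : X ≤ j.range
  · simp [hX]
  · simp [hX, subgroupMu_of_not_le hX]

variable {F : Type v} [Field F]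

/-- The Möbius transform `H ↦ ∑_Y μ(Y, H) w(Y)` of a function on subgroups. -/
def moebiusCoeff (w : Subgroup G → F) (H : Subgroup G) : F :=
  ∑ Y : Subgroup G, (subgroupMu G Y H : F) * w Y

theorem sum_moebiusCoeff (w : Subgroup G → F) (Z : Subgroup G) :
    (∑ H : Subgroup G, if H ≤ Z then moebiusCoeff w H else 0) = w Z := by
  calc _ = ∑ H, ∑ Y, (if H ≤ Z then (subgroupMu G Y H : F) else 0) * w Y := by
        refine Finset.sum_congr rfl fun H _ => ?_
        by_cases h : H ≤ Z <;> simp [h, moebiusCoeff]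
    _ = ∑ Y, (if Y = Z then 1 else 0) * w Y := by
        rw [Finset.sum_comm]
        simp_rw [← Finset.sum_mul, sum_cast_subgroupMu_right]
    _ = w Z := by simp

/-- Weisner's theorem. -/
theorem moebiusCoeff_eq_zero {w : Subgroup G → F} {A H : Subgroup G}
    (hw : ∀ X, w X = w (X ⊓ A)) (hA : ¬ H ≤ A) : moebiusCoeff w H = 0 := by
  -- Replace w(Y) = w(Y ⊓ A) by the sum of the coefficients at all Z below both Y and A. Summing
  -- over Y first leaves a Kronecker delta at Z = H, which is incompatible with Z ≤ A.
  calc moebiusCoeff w H = ∑ Y, (subgroupMu G Y H : F) *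
        ∑ Z, (if Z ≤ Y ⊓ A then moebiusCoeff w Z else 0) := by
        rw [moebiusCoeff]
        simp_rw [sum_moebiusCoeff, ← hw]
    _ = ∑ Z, (if Z ≤ A then moebiusCoeff w Z else 0) *
        ∑ Y, (if Z ≤ Y then (subgroupMu G Y H : F) else 0) := by
        simp_rw [Finset.mul_sum]
        rw [Finset.sum_comm]
        refine Finset.sum_congr rfl fun Z _ => Finset.sum_congr rfl fun Y _ => ?_
        by_cases h1 : Z ≤ A <;> by_cases h2 : Z ≤ Y <;> simp [h1, h2, mul_comm]
    _ = 0 := by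
        simp_rw [sum_cast_subgroupMu_left]
        refine Finset.sum_eq_zero fun Z _ => ?_
        by_cases h : Z = H
        · subst h; simp [hA]
        · simp [h]

theorem moebiusCoeff_range (j : Q →* G) (hj : Function.Injective j) (w : Subgroup G → F) :
    moebiusCoeff w j.range = moebiusCoeff (fun A : Subgroup Q => w (A.map j)) ⊤ := by
  simp_rw [moebiusCoeff, ← subgroupMu_map_range j hj]
  rw [sum_map_of_injective j hj (fun X => (subgroupMu G X j.range : F) * w X)]
  refine Finset.sum_congr rfl fun X _ => ?_
  by_cases hX : X ≤ j.range
  · simp [hX]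
  · simp [hX, subgroupMu_of_not_le hX]

theorem moebiusCoeff_const_mul (c : F) (w : Subgroup G → F) (H : Subgroup G) :
    moebiusCoeff (fun X => c * w X) H = c * moebiusCoeff w H := by
  simp only [moebiusCoeff, Finset.mul_sum]
  exact Finset.sum_congr rfl fun X _ => by ring

/-- The weight `X ↦ |X|` if `X S = G`, and `0` otherwise. -/
def supplementWeight (F : Type v) [Field F] (S X : Subgroup G) : F :=
  if X ⊔ S = ⊤ then (Nat.card X : F) else 0

theorem mConst_eq_moebiusCoeff (F : Type v) [Field F] [CharZero F] (N : Subgroup G) [N.Normal] :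
    (mConst G N : F) = (Nat.card G : F)⁻¹ * moebiusCoeff (supplementWeight F N) ⊤ := by
  rw [mConst, finsum_eq_sum_of_fintype]
  simp_rw [finsum_eq_if]
  push_cast
  congr 1
  rw [moebiusCoeff]
  refine Finset.sum_congr rfl fun X _ => ?_
  have h : ((X : Set G) * (N : Set G) = Set.univ) = (X ⊔ N = ⊤) := by
    rw [← Subgroup.mul_normal, ← Subgroup.coe_top, SetLike.coe_set_eq]
  simp only [h, supplementWeight]
  split_ifs <;> simp [mul_comm]

theorem mConst_ne_zero_iff (F : Type v) [Field F] [CharZero F] (N : Subgroup G) [N.Normal] :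
    mConst G N ≠ 0 ↔ moebiusCoeff (supplementWeight F N) ⊤ ≠ 0 := by
  rw [← Rat.cast_ne_zero (α := F), mConst_eq_moebiusCoeff]
  simp

/-- By Möbius inversion it suffices to sum over the images containing A. That sum is the top Möbius
coefficient of a weight depending only on X ⊓ q⁻¹(A), so Weisner's theorem kills it unless A = Q. -/
theorem sum_card_inf_ker_mul_subgroupMu (q : G →* Q) (hq : Function.Surjective q)
    (A : Subgroup Q) :
    (∑ X : Subgroup G, if X.map q = A then
      (Nat.card (X ⊓ q.ker : Subgroup G) : ℚ) * subgroupMu G X ⊤ else 0) =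
    (∑ X : Subgroup G, if X.map q = ⊤ then
      (Nat.card (X ⊓ q.ker : Subgroup G) : ℚ) * subgroupMu G X ⊤ else 0) *
      subgroupMu Q A ⊤ := by
  refine eq_mul_subgroupMu_of_sum_eq (fun A => ∑ X : Subgroup G, if X.map q = A then
      (Nat.card (X ⊓ q.ker : Subgroup G) : ℚ) * subgroupMu G X ⊤ else 0) _ ⊤ (fun A => ?_) A
  let w : Subgroup G → ℚ := fun X =>
    if A ≤ X.map q then (Nat.card (X ⊓ q.ker : Subgroup G) : ℚ) else 0
  have h1 : (∑ B : Subgroup Q, if A ≤ B then ∑ X : Subgroup G, if X.map q = B then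
      (Nat.card (X ⊓ q.ker : Subgroup G) : ℚ) * subgroupMu G X ⊤ else 0 else 0) =
      moebiusCoeff w ⊤ := by
    calc _ = ∑ B : Subgroup Q, ∑ X : Subgroup G, if X.map q = B then
          (if A ≤ X.map q then (Nat.card (X ⊓ q.ker : Subgroup G) : ℚ) * subgroupMu G X ⊤
            else 0) else 0 := by
          refine Finset.sum_congr rfl fun B _ => ?_
          split_ifs with h
          · refine Finset.sum_congr rfl fun X _ => ?_
            by_cases h2 : X.map q = B
            · subst h2; simp [h]
            · simp [h2]
          · refine (Finset.sum_eq_zero fun X _ => ?_).symm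
            by_cases h2 : X.map q = B
            · subst h2; simp [h]
            · simp [h2]
      _ = _ := by
          rw [Finset.sum_comm]
          refine Finset.sum_congr rfl fun X _ => ?_
          rw [Finset.sum_ite_eq]
          by_cases h : A ≤ X.map q <;> simp [w, h, mul_comm]
  rw [h1]
  split_ifs with hA
  · subst hA
    simp only [moebiusCoeff, w, top_le_iff]
    refine Finset.sum_congr rfl fun X _ => ?_
    split_ifs <;> simp [mul_comm]
  · refine moebiusCoeff_eq_zero (A := A.comap q) (fun X => ?_) (fun h => hA ?_)
    · have e1 : X ⊓ A.comap q ⊓ q.ker = X ⊓ q.ker := by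
        rw [inf_assoc, inf_eq_right.2 (Subgroup.ker_le_comap q A)]
      simp only [w, map_inf_comap, e1, le_inf_iff, le_refl, and_true]
    · rw [← Subgroup.comap_top q, Subgroup.comap_le_comap_of_surjective hq] at h
      exact top_le_iff.1 h

/-- Multiplicativity of the constants `m_{L,N}`. -/
theorem mConst_comap (q : G →* Q) (hq : Function.Surjective q) (N : Subgroup Q) [N.Normal] :
    mConst G (N.comap q) = mConst G q.ker * mConst Q N := by
  set C : ℚ := ∑ X : Subgroup G, if X.map q = ⊤ then
      (Nat.card (X ⊓ q.ker : Subgroup G) : ℚ) * subgroupMu G X ⊤ else 0 with hC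
  -- Group the subgroups X of G by their image in Q: the condition on X depends only on the image,
  -- and |X| = |q(X)| · |X ∩ Ker q|.
  have key : ∀ (N : Subgroup Q), moebiusCoeff (supplementWeight ℚ (N.comap q)) ⊤ =
      C * moebiusCoeff (supplementWeight ℚ N) ⊤ := fun N => by
    simp only [moebiusCoeff, supplementWeight, sup_comap_eq_top_iff q hq, hC, Finset.mul_sum]
    have h1 : ∀ A : Subgroup Q, C * (subgroupMu Q A ⊤ : ℚ) = ∑ X : Subgroup G,
        if X.map q = A then (Nat.card (X ⊓ q.ker : Subgroup G) : ℚ) * subgroupMu G X ⊤ else 0 :=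
      fun A => (sum_card_inf_ker_mul_subgroupMu q hq A).symm
    simp_rw [← hC, ← mul_assoc, h1, Finset.sum_mul]
    rw [Finset.sum_comm]
    refine Finset.sum_congr rfl fun X _ => ?_
    rw [Finset.sum_eq_single (X.map q) (fun A _ hA => by simp [hA.symm]) (by simp)]
    simp only [if_true]
    split_ifs
    · rw [← card_map_mul_card_inf_ker q X]
      push_cast
      ring
    · simp
  have hG : (Nat.card G : ℚ) ≠ 0 := Nat.cast_ne_zero.2 Nat.card_pos.ne'
  have hQ : (Nat.card Q : ℚ) ≠ 0 := Nat.cast_ne_zero.2 Nat.card_pos.ne'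
  -- Only Q itself supplements the trivial subgroup; `key ⊥` therefore identifies the factor `C`
  -- with |G| m_{G, Ker q} / |Q|.
  have hbot : moebiusCoeff (supplementWeight ℚ (⊥ : Subgroup Q)) ⊤ = Nat.card Q := by
    rw [moebiusCoeff, Finset.sum_eq_single ⊤]
    · have := sum_subgroupMu_left (⊤ : Subgroup Q) ⊤
      simp only [top_le_iff] at this
      simp [supplementWeight] at this ⊢
      simp [this]
    · intro X _ hX
      simp [supplementWeight, hX]
    · simp
  have e1 := mConst_eq_moebiusCoeff ℚ (N.comap q)
  have e2 := mConst_eq_moebiusCoeff ℚ N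
  have e3 := mConst_eq_moebiusCoeff ℚ q.ker
  have e4 := key ⊥
  rw [MonoidHom.comap_bot, hbot] at e4
  simp only [Rat.cast_id] at e1 e2 e3
  rw [e1, e2, e3, e4, key N]
  field_simp

end Moebius

/-! ## Linear forms on the Burnside algebra, marks and idempotents -/

section Weights

variable {F : Type v} [Field F] {G : Type u} [Group G]

theorem stabilizer_equiv {A B : Type*} [MulAction G A] [MulAction G B] (e : A ≃ B)
    (he : ∀ (g : G) (x : A), e (g • x) = g • e x) (x : A) :
    MulAction.stabilizer G (e x) = MulAction.stabilizer G x := by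
  ext g
  rw [MulAction.mem_stabilizer_iff, MulAction.mem_stabilizer_iff, ← he, e.injective.eq_iff]

namespace FB

theorem cls_eq_of_iso {A B : FinGSet G} (h : FinGSet.Iso A B) : cls F A = cls F B := by
  have : IsoClass.mk A = IsoClass.mk B := Quotient.sound h
  rw [cls, cls, this]

theorem cls_sum (A B : FinGSet G) : cls F (A.sum B) = cls F A + cls F B :=
  (ι F G).map_add (IsoClass.mk A) (IsoClass.mk B)

/-- The linear map sending the class of a `G`-set `A` to `∑_{a ∈ A} w(G_a)`, for a function `w` on
the subgroups of `G`. -/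
def weight {V : Type*} [AddCommGroup V] [Module F V] (w : Subgroup G → V) : FB F G →ₗ[F] V :=
  lift F
    { toFun := Quotient.lift
        (fun A : FinGSet G => ∑ a : A.carrier, w (MulAction.stabilizer G a)) (by
          rintro A B ⟨e, he⟩
          refine Fintype.sum_equiv e _ _ fun a => ?_
          rw [stabilizer_equiv e he])
      map_zero' := Finset.sum_eq_zero fun x _ => (x : PEmpty.{u + 1}).elim
      map_add' := by
        rintro ⟨A⟩ ⟨B⟩
        change ∑ c : (A.sum B).carrier, w (MulAction.stabilizer G c) =
          ∑ a : A.carrier, w (MulAction.stabilizer G a) +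
            ∑ b : B.carrier, w (MulAction.stabilizer G b)
        have hl (a : A.carrier) : MulAction.stabilizer G (Sum.inl a : (A.sum B).carrier) =
            MulAction.stabilizer G a := by
          ext g; exact Sum.inl_injective.eq_iff
        have hr (b : B.carrier) : MulAction.stabilizer G (Sum.inr b : (A.sum B).carrier) =
            MulAction.stabilizer G b := by
          ext g; exact Sum.inr_injective.eq_iff
        simp_rw [← hl, ← hr]
        refine Eq.trans ?_ (Fintype.sum_sum_type (α₁ := A.carrier) (α₂ := B.carrier)
          fun c => w (MulAction.stabilizer G (show (A.sum B).carrier from c)))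
        exact Fintype.sum_equiv
          (show (A.sum B).carrier ≃ A.carrier ⊕ B.carrier from Equiv.refl _) _ _ fun _ => rfl }

theorem weight_cls {V : Type*} [AddCommGroup V] [Module F V] (w : Subgroup G → V)
    (A : FinGSet G) :
    weight w (cls F A) = ∑ a : A.carrier, w (MulAction.stabilizer G a) :=
  lift_cls F _ A

/-- The complement of an orbit in a `G`-set. -/
def _root_.RelativeBurnside.FinGSet.complOrbit (A : FinGSet G) (a : A.carrier) : FinGSet G :=
  letI : MulAction G {x : A.carrier // x ∉ MulAction.orbit G a} :=
    { smul := fun g x => ⟨g • x.1, fun h => x.2 (by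
        simpa using MulAction.mem_orbit_of_mem_orbit g⁻¹ h)⟩
      one_smul := fun x => Subtype.ext (one_smul G x.1)
      mul_smul := fun g h x => Subtype.ext (mul_smul g h x.1) }
  { carrier := {x : A.carrier // x ∉ MulAction.orbit G a} }

theorem cls_eq_zero (A : FinGSet G) [hA : IsEmpty A.carrier] : cls F A = 0 := by
  rw [← (ι F G).map_zero]
  refine cls_eq_of_iso (B := FinGSet.empty G) ⟨Equiv.equivOfIsEmpty A.carrier PEmpty, ?_⟩
  exact fun _ x => (hA.false x).elim

theorem stabilizer_quotient_mk (X : Subgroup G) (g : G) :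
    MulAction.stabilizer G (g : G ⧸ X) = X.map (MulAut.conj g).toMonoidHom := by
  have h : (g : G ⧸ X) = g • ((1 : G) : G ⧸ X) := by simp
  rw [h, MulAction.stabilizer_smul_eq_stabilizer_map_conj, MulAction.stabilizer_quotient]

variable [Finite G]

theorem cls_eq_quotient_add (A : FinGSet G) (a : A.carrier) :
    cls F A = cls F (FinGSet.quotient (MulAction.stabilizer G a)) + cls F (A.complOrbit a) := by
  rw [← cls_sum]
  symm
  refine cls_eq_of_iso ⟨Equiv.ofBijective
    (Sum.elim (MulAction.ofQuotientStabilizer G a) Subtype.val) ⟨?_, ?_⟩, ?_⟩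
  · rintro (x | x) (y | y) h
    · exact congrArg Sum.inl (MulAction.injective_ofQuotientStabilizer G a h)
    · exact (y.2 ((show _ = y.1 from h) ▸ MulAction.ofQuotientStabilizer_mem_orbit G a x)).elim
    · exact (x.2 ((show x.1 = _ from h) ▸ MulAction.ofQuotientStabilizer_mem_orbit G a y)).elim
    · exact congrArg Sum.inr (Subtype.ext h)
  · intro x
    by_cases hx : x ∈ MulAction.orbit G a
    · obtain ⟨g, rfl⟩ := hx
      exact ⟨Sum.inl (g : G ⧸ MulAction.stabilizer G a), rfl⟩
    · exact ⟨Sum.inr ⟨x, hx⟩, rfl⟩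
  · rintro g (x | x)
    · exact MulAction.ofQuotientStabilizer_smul G a g x
    · rfl

/-- Split off one orbit at a time, by induction on the size of the set. -/
theorem hom_ext_quotient {V : Type*} [AddCommGroup V] [Module F V] {f g : FB F G →ₗ[F] V}
    (h : ∀ X : Subgroup G, f (cls F (FinGSet.quotient X)) = g (cls F (FinGSet.quotient X))) :
    f = g := by
  refine hom_ext F fun A => ?_
  induction hn : Nat.card A.carrier using Nat.strong_induction_on generalizing A with
  | _ n ih =>
    rcases isEmpty_or_nonempty A.carrier with hA | ⟨⟨a⟩⟩
    · rw [cls_eq_zero, map_zero, map_zero]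
    · rw [cls_eq_quotient_add A a, map_add, map_add, h, ih _ ?_ _ rfl]
      rw [← hn]
      exact Finite.card_subtype_lt (x := a) (by simp)

omit [Finite G] in
theorem conj_surjective (g : G) : Function.Surjective (MulAut.conj g).toMonoidHom :=
  (MulAut.conj g).surjective

theorem cls_quotient_conj (X : Subgroup G) (g : G) :
    cls F (FinGSet.quotient (X.map (MulAut.conj g).toMonoidHom)) =
      cls F (FinGSet.quotient X) := by
  have h : IsEmpty ((FinGSet.quotient X).complOrbit (g : G ⧸ X)).carrier :=
    ⟨fun x => x.2 (MulAction.exists_smul_eq G (g : G ⧸ X) (x.1 : G ⧸ X))⟩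
  rw [← stabilizer_quotient_mk]
  have h2 := cls_eq_quotient_add (F := F) (FinGSet.quotient X) (g : G ⧸ X)
  rw [cls_eq_zero ((FinGSet.quotient X).complOrbit (g : G ⧸ X)), add_zero] at h2
  exact h2.symm

/-- The coset gX has stabilizer gXg⁻¹ and is represented by |X| elements g. Keeping the factor |X|
avoids division and matches the |X| of Gluck's formula. -/
theorem card_smul_weight_quotient {V : Type*} [AddCommGroup V] [Module F V] (w : Subgroup G → V)
    (X : Subgroup G) :
    (Nat.card X : F) • weight w (cls F (FinGSet.quotient X)) =
      ∑ g : G, w (X.map (MulAut.conj g).toMonoidHom) := by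
  have h0 : ∑ a : (FinGSet.quotient X).carrier, w (MulAction.stabilizer G a) =
      ∑ c : G ⧸ X, w (MulAction.stabilizer G c) :=
    Fintype.sum_equiv (show (FinGSet.quotient X).carrier ≃ G ⧸ X from Equiv.refl _) _ _
      fun _ => rfl
  rw [weight_cls, h0]
  simp_rw [← stabilizer_quotient_mk]
  rw [Finset.smul_sum,
    ← Finset.sum_fiberwise (s := Finset.univ) (g := fun g : G => (QuotientGroup.mk g : G ⧸ X))]
  refine Finset.sum_congr rfl fun c _ => ?_
  have h := QuotientGroup.card_preimage_mk X {c}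
  rw [Finset.sum_congr rfl (g := fun _ => w (MulAction.stabilizer G c)), Finset.sum_const]
  · rw [← Nat.cast_smul_eq_nsmul F]
    congr 2
    rw [Nat.card_unique (α := ({c} : Set (G ⧸ X))), mul_one, Nat.card_eq_card_toFinset] at h
    rw [← h]
    congr 1
    ext
    simp
  · intro g hg
    simp at hg
    rw [hg]

/-- Orbit–stabilizer: an orbit contributes its length times |G_a| times its own class. Thus an
element is recovered, up to |G|, from a single vector-valued weight. -/
theorem weight_card_smul_cls_quotient [CharZero F] :
    weight (fun Y : Subgroup G => (Nat.card Y : F) • cls F (FinGSet.quotient Y)) =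
      (Nat.card G : F) • LinearMap.id := by
  refine hom_ext_quotient fun X => ?_
  have hX : (Nat.card X : F) ≠ 0 := Nat.cast_ne_zero.2 Nat.card_pos.ne'
  refine smul_right_injective _ hX ?_
  simp only [card_smul_weight_quotient, cls_quotient_conj]
  have : ∀ g : G, Nat.card (X.map (MulAut.conj g).toMonoidHom) = Nat.card X := fun g =>
    Nat.card_congr (X.equivMapOfInjective _ (MulAut.conj g).injective).symm.toEquiv
  simp only [this, Finset.sum_const, LinearMap.smul_apply, LinearMap.id_apply]
  rw [← Nat.cast_smul_eq_nsmul F, Finset.card_univ, ← Nat.card_eq_fintype_card, smul_comm]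

/-- The mark at a subgroup `H`: the linear extension of `A ↦ |A^H|`. -/
def mark (F : Type v) [Field F] (H : Subgroup G) : FB F G →ₗ[F] F :=
  weight fun Y => if H ≤ Y then 1 else 0

/-- Möbius inversion expands w in indicators of the form H ≤ Y, whose weights are the marks. -/
theorem weight_eq_sum_mark (w : Subgroup G → F) (x : FB F G) :
    weight w x = ∑ H, moebiusCoeff w H * mark F H x := by
  have h : weight w = ∑ H, moebiusCoeff w H • mark F H := by
    refine hom_ext F fun A => ?_
    simp only [LinearMap.sum_apply, LinearMap.smul_apply, mark, weight_cls, smul_eq_mul,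
      Finset.mul_sum]
    rw [Finset.sum_comm]
    refine Finset.sum_congr rfl fun a _ => ?_
    simp [← sum_moebiusCoeff w (MulAction.stabilizer G a)]
  rw [h]
  simp

theorem weight_eq_sum_smul {V : Type*} [AddCommGroup V] [Module F V] (w : Subgroup G → V)
    (x : FB F G) :
    weight w x = ∑ Y, weight (fun Z => if Z = Y then (1 : F) else 0) x • w Y := by
  have h : weight w =
      ∑ Y, (weight (F := F) fun Z => if Z = Y then (1 : F) else 0).smulRight (w Y) := by
    refine hom_ext F fun A => ?_
    simp only [LinearMap.sum_apply, LinearMap.smulRight_apply, weight_cls, Finset.sum_smul]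
    rw [Finset.sum_comm]
    exact Finset.sum_congr rfl fun a _ => by simp
  rw [h]
  simp

/-- An element of the Burnside algebra is determined by its marks. -/
theorem eq_of_mark_eq [CharZero F] {x y : FB F G}
    (h : ∀ H : Subgroup G, mark F H x = mark F H y) : x = y := by
  have hw (w : Subgroup G → F) : weight w x = weight w y := by
    simp_rw [weight_eq_sum_mark, h]
  have hG : (Nat.card G : F) ≠ 0 := Nat.cast_ne_zero.2 Nat.card_pos.ne'
  refine smul_right_injective _ hG ?_
  have hx := LinearMap.congr_fun (weight_card_smul_cls_quotient (F := F) (G := G)) x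
  have hy := LinearMap.congr_fun (weight_card_smul_cls_quotient (F := F) (G := G)) y
  simp only [LinearMap.smul_apply, LinearMap.id_apply] at hx hy
  simp only [← hx, ← hy]
  rw [weight_eq_sum_smul, weight_eq_sum_smul]
  simp_rw [hw]

theorem idem_eq_sum (L : Subgroup G) :
    idem F L = (Nat.card (Subgroup.normalizer (L : Set G)) : F)⁻¹ • ∑ X : Subgroup G,
      (subgroupMu G X L : F) • (Nat.card X : F) • cls F (FinGSet.quotient X) := by
  rw [idem, finsum_eq_sum_of_fintype]
  simp_rw [finsum_eq_if]
  congr 1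
  refine Finset.sum_congr rfl fun X _ => ?_
  split_ifs with h
  · rw [smul_smul, mul_comm]
  · simp [subgroupMu_of_not_le h]

theorem weight_idem (w : Subgroup G → F) (L : Subgroup G) :
    weight w (idem F L) = (Nat.card (Subgroup.normalizer (L : Set G)) : F)⁻¹ *
      ∑ g : G, moebiusCoeff (fun X => w (X.map (MulAut.conj g).toMonoidHom)) L := by
  rw [idem_eq_sum, map_smul, smul_eq_mul, map_sum]
  simp only [moebiusCoeff]
  rw [Finset.sum_comm]
  simp_rw [← Finset.mul_sum, ← card_smul_weight_quotient (F := F), map_smul, smul_eq_mul]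

/-- The Möbius coefficient at L of the indicator of an up-set {X | B ≤ X} is the Kronecker delta of
B and L; here B is a conjugate of H. -/
theorem mark_idem (H L : Subgroup G) :
    mark F H (idem F L) = (Nat.card (Subgroup.normalizer (L : Set G)) : F)⁻¹ *
      (Finset.univ.filter fun g : G => L.map (MulAut.conj g).toMonoidHom = H).card := by
  rw [mark, weight_idem, Finset.card_filter]
  push_cast
  congr 1
  refine Finset.sum_congr rfl fun g _ => ?_
  have h1 (X : Subgroup G) : H ≤ X.map (MulAut.conj g).toMonoidHom ↔
      H.comap (MulAut.conj g).toMonoidHom ≤ X := by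
    rw [← Subgroup.comap_le_comap_of_surjective (conj_surjective g),
      Subgroup.comap_map_eq_self_of_injective (MulAut.conj g).injective]
  have h2 : L.map (MulAut.conj g).toMonoidHom = H ↔
      H.comap (MulAut.conj g).toMonoidHom = L := by
    rw [← (Subgroup.comap_injective (conj_surjective g)).eq_iff,
      Subgroup.comap_map_eq_self_of_injective (MulAut.conj g).injective, eq_comm]
  simp only [moebiusCoeff, h1, h2, mul_ite, mul_one, mul_zero, sum_cast_subgroupMu_left]

theorem mark_idem_ne_zero_iff [CharZero F] (H L : Subgroup G) :
    mark F H (idem F L) ≠ 0 ↔ ∃ g : G, L.map (MulAut.conj g).toMonoidHom = H := by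
  have h : (Nat.card (Subgroup.normalizer (L : Set G)) : F) ≠ 0 :=
    Nat.cast_ne_zero.2 Nat.card_pos.ne'
  rw [mark_idem, mul_ne_zero_iff, Nat.cast_ne_zero, Finset.card_ne_zero]
  simp only [ne_eq, inv_eq_zero, h, not_false_eq_true, true_and]
  exact ⟨fun ⟨g, hg⟩ => ⟨g, (Finset.mem_filter.1 hg).2⟩,
    fun ⟨g, hg⟩ => ⟨g, Finset.mem_filter.2 ⟨Finset.mem_univ _, hg⟩⟩⟩

omit [Finite G] in
theorem mark_conj (g : G) (H : Subgroup G) :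
    mark F (H.map (MulAut.conj g).toMonoidHom) = mark F H := by
  refine hom_ext F fun A => ?_
  rw [mark, mark, weight_cls, weight_cls]
  symm
  refine Fintype.sum_equiv (MulAction.toPerm g) _ _ fun a => ?_
  rw [MulAction.toPerm_apply, MulAction.stabilizer_smul_eq_stabilizer_map_conj]
  simp only [Subgroup.map_le_map_iff_of_injective
    (show Function.Injective (MulAut.conj g).toMonoidHom from (MulAut.conj g).injective)]

theorem mark_quotient_self_ne_zero [CharZero F] (Y : Subgroup G) :
    mark F Y (cls F (FinGSet.quotient Y)) ≠ 0 := by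
  refine right_ne_zero_of_smul (a := (Nat.card Y : F)) ?_
  rw [mark, card_smul_weight_quotient, Finset.sum_boole, Nat.cast_ne_zero, Finset.card_ne_zero]
  refine ⟨1, Finset.mem_filter.2 ⟨Finset.mem_univ _, fun y hy => ⟨y, hy, ?_⟩⟩⟩
  simp

/-- A fixed coset would put Y inside a conjugate of X, which is too small. -/
theorem mark_quotient_of_lt [CharZero F] {X Y : Subgroup G} (h : X < Y) :
    mark F Y (cls F (FinGSet.quotient X)) = 0 := by
  have hX : (Nat.card X : F) ≠ 0 := Nat.cast_ne_zero.2 Nat.card_pos.ne'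
  refine (smul_eq_zero_iff_right hX).1 ?_
  rw [mark, card_smul_weight_quotient]
  refine Finset.sum_eq_zero fun g _ => if_neg fun hg => ?_
  have h1 := Subgroup.card_le_of_le hg
  rw [Subgroup.card_map_of_injective (MulAut.conj g).injective] at h1
  exact h.ne (Subgroup.eq_of_le_of_card_ge h.le h1)

end FB
end Weights

/-! ## Restriction, products and bisets attached to homomorphisms -/

section Operations

variable {F : Type v} [Field F] {G H K : Type u} [Group G] [Group H] [Group K]

namespace FB

theorem res_cls (f : G →* H) (A : FinGSet H) : res F f (cls F A) = cls F (A.res f) :=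
  lift_cls F _ A

theorem bisetMap_cls (U : FinBiset H G) (A : FinGSet G) :
    bisetMap F U (cls F A) = cls F (U.balancedProd A) :=
  lift_cls F _ A

theorem extProd_cls (A : FinGSet G) (B : FinGSet H) :
    extProd F G H (cls F A) (cls F B) = cls F (A.extProd B) := by
  rw [extProd, lift_cls]
  exact lift_cls F _ B

theorem weight_res {V : Type*} [AddCommGroup V] [Module F V] (f : G →* H) (w : Subgroup G → V)
    (x : FB F H) : weight w (res F f x) = weight (fun Y => w (Y.comap f)) x := by
  refine LinearMap.congr_fun (f := (weight w).comp (res F f)) (hom_ext F fun A => ?_) x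
  rw [LinearMap.comp_apply, res_cls, weight_cls, weight_cls]
  rfl

theorem mark_res (f : G →* H) (X : Subgroup G) (x : FB F H) :
    mark F X (res F f x) = mark F (X.map f) x := by
  simp_rw [mark, weight_res, Subgroup.map_le_iff_le_comap]

theorem weight_cls_extProd {V : Type*} [AddCommGroup V] [Module F V] (w : Subgroup (G × H) → V)
    (A : FinGSet G) (B : FinGSet H) :
    weight w (cls F (A.extProd B)) =
      ∑ a : A.carrier, ∑ b : B.carrier,
        w ((MulAction.stabilizer G a).prod (MulAction.stabilizer H b)) := by
  rw [weight_cls, ← Fintype.sum_prod_type']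
  refine Fintype.sum_equiv
    (show (A.extProd B).carrier ≃ A.carrier × B.carrier from Equiv.refl _) _ _ fun c => ?_
  refine congrArg w ?_
  ext g
  exact Prod.ext_iff

theorem mark_extProd (X : Subgroup (G × H)) (x : FB F G) (y : FB F H) :
    mark F X (extProd F G H x y) =
      mark F (X.map (MonoidHom.fst G H)) x * mark F (X.map (MonoidHom.snd G H)) y := by
  have h : (extProd F G H).compr₂ (mark F X) =
      (LinearMap.mul F F).compl₁₂ (mark F (X.map (MonoidHom.fst G H)))
        (mark F (X.map (MonoidHom.snd G H))) := by
    refine hom_ext F fun A => hom_ext F fun B => ?_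
    rw [LinearMap.compr₂_apply, extProd_cls, LinearMap.compl₁₂_apply, LinearMap.mul_apply',
      mark, weight_cls_extProd, mark, mark, weight_cls, weight_cls, Finset.sum_mul_sum]
    simp_rw [Subgroup.le_prod_iff, mul_ite, mul_one, mul_zero, ← ite_and, and_comm]
  exact LinearMap.congr_fun₂ h x y

end FB

/-- The `(G, H)`-biset `H`, where `G` acts through `f : G → H`. -/
def homBiset [Finite H] (f : G →* H) : FinBiset G H :=
  letI : MulAction G H := MulAction.compHom H f
  letI : SMulCommClass G Hᵐᵒᵖ H := ⟨fun g h x => (mul_assoc (f g) x h.unop).symm⟩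
  { carrier := H }

/-- The `(H, G)`-biset `H`, where `G` acts through `f : G → H`. -/
def homBisetOp [Finite H] (f : G →* H) : FinBiset H G :=
  letI : MulAction Gᵐᵒᵖ H := MulAction.compHom H f.op
  letI : SMulCommClass H Gᵐᵒᵖ H := ⟨fun h g x => (mul_assoc h x (f g.unop)).symm⟩
  { carrier := H }

/-- The homomorphism `f × K`. -/
abbrev shiftHom (K : Type u) [Group K] (f : G →* H) : G × K →* H × K :=
  f.prodMap (MonoidHom.id K)

/-- The internal product of `𝔽B_K(G)`. -/
def imul (x y : FBK F K G) : FBK F K G :=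
  FB.res F (shiftHom K ((MonoidHom.id G).prod (MonoidHom.id G))) (FBK.prod F K G G x y)

/-- Both projections of the diagonal image of X are X itself, so marks are multiplicative. -/
theorem mark_imul (X : Subgroup (G × K)) (x y : FBK F K G) :
    FB.mark F X (imul x y) = FB.mark F X x * FB.mark F X y := by
  rw [imul, FBK.prod, FB.mark_res, LinearMap.compr₂_apply, FB.mark_res, FB.mark_extProd]
  simp only [Subgroup.map_map]
  congr 3 <;> exact Subgroup.map_id X

variable [Finite K] [Finite H]

theorem bisetMap_homBiset (f : G →* H) :
    FBK.bisetMap F K (homBiset f) = FB.res F (shiftHom K f) := by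
  refine FB.hom_ext F fun A => ?_
  rw [FBK.bisetMap, FB.bisetMap_cls, FB.res_cls]
  refine FB.cls_eq_of_iso ⟨⟨Quotient.lift
    (fun z : (H × K) × A.carrier => (z.1 • z.2 : A.carrier)) ?_,
    fun a => Quotient.mk _ ((1 : H × K), a), ?_, ?_⟩, ?_⟩
  · rintro a b ⟨g, rfl⟩
    obtain ⟨u, a⟩ := a
    change (show H × K from u) • a = ((show H × K from u) * g) • g⁻¹ • a
    rw [smul_smul, mul_inv_cancel_right]
  · rintro ⟨z⟩
    refine Quotient.sound ⟨z.1, Prod.ext ?_ ?_⟩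
    · exact (one_mul (show H × K from z.1)).symm
    · exact (inv_smul_smul (show H × K from z.1) z.2).symm
  · intro a
    exact one_smul (H × K) (show A.carrier from a)
  · rintro g ⟨z⟩
    exact mul_smul (shiftHom K f g) (show H × K from z.1) (show A.carrier from z.2)

/-- Pushing forward a transitive set takes the image of its point stabilizer. This makes the
pushforward of Gluck's formula explicit. -/
theorem bisetMap_homBisetOp_quotient [Finite G] (f : G →* H) (X : Subgroup (G × K)) :
    FBK.bisetMap F K (homBisetOp f) (FB.cls F (FinGSet.quotient X)) =
      FB.cls F (FinGSet.quotient (X.map (shiftHom K f))) := by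
  rw [FBK.bisetMap, FB.bisetMap_cls]
  let e : (G × K) ⧸ X → (H × K) ⧸ X.map (shiftHom K f) :=
    Quotient.map' (shiftHom K f) fun a b h => by
      rw [QuotientGroup.leftRel_apply] at h ⊢
      rw [← map_inv, ← map_mul]
      exact Subgroup.mem_map_of_mem _ h
  have he (g : G × K) (c : (G × K) ⧸ X) : e (g • c) = shiftHom K f g • e c := by
    induction c using QuotientGroup.induction_on
    exact congrArg QuotientGroup.mk (map_mul _ _ _)
  have key (u : H × K) (c : (G × K) ⧸ X) (g : G × K) :
      (u * shiftHom K f g) • e (g⁻¹ • c) = u • e c := by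
    rw [he, mul_smul, smul_smul _ _ (e c), map_inv, mul_inv_cancel, one_smul]
  refine FB.cls_eq_of_iso ⟨Equiv.ofBijective (Quotient.lift
    (fun z : (H × K) × ((G × K) ⧸ X) => z.1 • e z.2) ?_) ⟨?_, ?_⟩, ?_⟩
  · rintro a b ⟨g, rfl⟩
    exact (key a.1 a.2 g).symm
  · rintro ⟨(u : H × K), c⟩ ⟨(v : H × K), d⟩ h
    change u • e c = v • e d at h
    induction c using QuotientGroup.induction_on with | _ c => ?_
    induction d using QuotientGroup.induction_on with | _ d => ?_
    obtain ⟨x, hx, hx2⟩ := Subgroup.mem_map.1 (QuotientGroup.eq.1 h)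
    refine Quotient.sound ⟨c * x * d⁻¹, Prod.ext ?_ ?_⟩
    · change v = u * shiftHom K f (c * x * d⁻¹)
      rw [map_mul, map_mul, hx2, map_inv]
      change v = u * (shiftHom K f c * ((u * shiftHom K f c)⁻¹ * (v * shiftHom K f d)) *
        (shiftHom K f d)⁻¹)
      group
    · refine QuotientGroup.eq.2 ?_
      simpa [mul_assoc] using hx
  · intro c
    induction c using QuotientGroup.induction_on with | _ u => ?_
    refine ⟨Quotient.mk _ ((u : H × K), ((1 : G × K) : (G × K) ⧸ X)), ?_⟩
    refine congrArg QuotientGroup.mk ?_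
    change u * shiftHom K f 1 = u
    rw [map_one, mul_one]
  · rintro h ⟨z⟩
    exact mul_smul h (show H × K from z.1) (e z.2)

end Operations

/-! ### Detecting idempotents in an ideal by marks -/

namespace GreenIdeal

variable {F : Type v} [Field F] {K : Type u} [Group K] [Finite K]
  {𝒟 : ∀ (G : Type u) [Group G], Prop} {G H : Type u} [Group G] [Finite G] [Group H] [Finite H]

theorem imul_mem (I : GreenIdeal F K 𝒟) (hG : 𝒟 G) (hGG : 𝒟 (G × G)) (x : FBK F K G)
    {y : FBK F K G} (hy : y ∈ I.carrier G hG) : imul x y ∈ I.carrier G hG := by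
  have h := I.bisetMap_mem hGG hG (homBiset ((MonoidHom.id G).prod (MonoidHom.id G))) _
    (I.prod_mem hG hG hGG x y hy)
  rwa [bisetMap_homBiset] at h

variable [CharZero F]

theorem idem_mem_of_mark_ne_zero (I : GreenIdeal F K 𝒟) (hG : 𝒟 G) (hGG : 𝒟 (G × G))
    {X : Subgroup (G × K)} {y : FBK F K G} (hy : y ∈ I.carrier G hG) (hX : FB.mark F X y ≠ 0) :
    idem F X ∈ I.carrier G hG := by
  have h : imul (idem F X) y = FB.mark F X y • idem F X := by
    refine FB.eq_of_mark_eq fun Y => ?_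
    rw [mark_imul, map_smul, smul_eq_mul, mul_comm]
    by_cases hY : FB.mark F Y (idem F X) = 0
    · rw [hY, mul_zero, mul_zero]
    · obtain ⟨g, rfl⟩ := (FB.mark_idem_ne_zero_iff Y X).1 hY
      rw [FB.mark_conj]
  have h2 := I.imul_mem hG hGG (idem F X) hy
  rw [h] at h2
  exact (Submodule.smul_mem_iff _ hX).1 h2

/-- The pullback of e_Y along f × K has at X the mark of e_Y at the image of X, which is nonzero
because that image is conjugate to Y. -/
theorem span_idem_le_of_map_eq (hG : 𝒟 G) (hH : 𝒟 H) (hGG : 𝒟 (G × G)) (f : G →* H)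
    {X : Subgroup (G × K)} {Y : Subgroup (H × K)}
    (h : ∃ g, Y.map (MulAut.conj g).toMonoidHom = X.map (shiftHom K f)) :
    span hG (idem F X) ≤ span hH (idem F Y) := by
  rw [span_le]
  have h2 := (span hH (idem F Y)).bisetMap_mem hH hG (homBiset f) _ (mem_span_self hH _)
  rw [bisetMap_homBiset] at h2
  refine idem_mem_of_mark_ne_zero _ hG hGG h2 ?_
  rw [FB.mark_res]
  exact (FB.mark_idem_ne_zero_iff _ _).2 h

/-- Deflation. -/
theorem span_idem_le_of_mConst_ne_zero (hG : 𝒟 G) (hH : 𝒟 H) (hHH : 𝒟 (H × H)) (f : G →* H)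
    {Q : Type u} [Group Q] [Finite Q] (j : Q →* G × K) (hj : Function.Injective j)
    {Y : Subgroup (H × K)}
    (h : ∃ g, Y.map (MulAut.conj g).toMonoidHom = j.range.map (shiftHom K f))
    (hm : mConst Q ((shiftHom K f).comp j).ker ≠ 0) :
    span hH (idem F Y) ≤ span hG (idem F j.range) := by
  rw [span_le]
  have h2 := (span hG (idem F j.range)).bisetMap_mem hG hH (homBisetOp f) _ (mem_span_self hG _)
  refine idem_mem_of_mark_ne_zero _ hH hHH h2 ?_
  obtain ⟨g, hg⟩ := h
  set f' := shiftHom K f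
  have hN : (Nat.card (Subgroup.normalizer (j.range : Set (G × K))) : F) ≠ 0 :=
    Nat.cast_ne_zero.2 Nat.card_pos.ne'
  -- The mark at the full image vanishes on the quotient by a proper subgroup of it. So only those A
  -- that supplement the kernel survive, each contributing |A| times a common factor.
  have hw (A : Subgroup Q) : (Nat.card (A.map j) : F) *
      FB.mark F (j.range.map f') (FB.cls F (FinGSet.quotient ((A.map j).map f'))) =
      FB.mark F (j.range.map f') (FB.cls F (FinGSet.quotient (j.range.map f'))) *
        supplementWeight F (f'.comp j).ker A := by
    have h1 : A ⊔ (f'.comp j).ker = ⊤ ↔ (A.map j).map f' = j.range.map f' := by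
      rw [MonoidHom.range_eq_map, Subgroup.map_map, Subgroup.map_map, Subgroup.map_eq_map_iff,
        top_sup_eq]
    rw [supplementWeight, Subgroup.card_map_of_injective hj]
    split_ifs with h2
    · rw [h1.1 h2, mul_comm]
    · rw [FB.mark_quotient_of_lt, mul_zero, mul_zero]
      exact lt_of_le_of_ne (Subgroup.map_mono (Subgroup.map_le_range j A)) (fun h3 => h2 (h1.2 h3))
  have hsum : FB.mark F (j.range.map f') (FBK.bisetMap F K (homBisetOp f) (idem F j.range)) =
      (Nat.card (Subgroup.normalizer (j.range : Set (G × K))) : F)⁻¹ *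
      moebiusCoeff (fun X => (Nat.card X : F) *
        FB.mark F (j.range.map f') (FB.cls F (FinGSet.quotient (X.map f')))) j.range := by
    rw [FB.idem_eq_sum]
    simp only [map_smul, map_sum, bisetMap_homBisetOp_quotient, smul_eq_mul, moebiusCoeff, f']
  rw [← FB.mark_conj g, hg, hsum, moebiusCoeff_range j hj]
  simp_rw [hw, moebiusCoeff_const_mul]
  exact mul_ne_zero (inv_ne_zero hN)
    (mul_ne_zero (FB.mark_quotient_self_ne_zero _) ((mConst_ne_zero_iff F _).1 hm))

end GreenIdeal

/-! ## Linear forms counting the fixed points of `T` on the orbits of a normal subgroup -/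

section FixedOrbits

variable {F : Type v} [Field F]

/-- The hypotheses make π the quotient map onto the set of orbits, and on each orbit the stabilizer
orders add up to |G|. -/
theorem sum_card_stabilizer_mul {G Z Y : Type*} [Group G] [Finite G] [Fintype Z] [Fintype Y]
    [MulAction G Z] {π : Z → Y} (hπ : Function.Surjective π)
    (h : ∀ z z', π z' = π z ↔ z' ∈ MulAction.orbit G z) (f : Y → F) :
    ∑ z, (Nat.card (MulAction.stabilizer G z) : F) * f (π z) = Nat.card G * ∑ y, f y := by
  rw [Finset.mul_sum, ← Finset.sum_fiberwise (s := Finset.univ) (g := π)]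
  refine Finset.sum_congr rfl fun y _ => ?_
  obtain ⟨z₀, rfl⟩ := hπ y
  have hc : ∀ z, π z = π z₀ → (Nat.card (MulAction.stabilizer G z) : F) * f (π z) =
      Nat.card (MulAction.stabilizer G z₀) * f (π z₀) := fun z hz => by
    obtain ⟨g, rfl⟩ := (h z₀ z).1 hz
    rw [hz, ← Nat.card_congr (MulAction.stabilizerEquivStabilizer (g := g) (a := z₀) rfl).toEquiv]
  rw [Finset.sum_congr rfl fun z hz => hc z (Finset.mem_filter.1 hz).2, Finset.sum_const,
    nsmul_eq_mul, ← mul_assoc]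
  congr 1
  rw [← Nat.cast_mul]
  congr 1
  have h2 := MulAction.card_orbit_mul_card_stabilizer_eq_card_group G z₀
  simp only [← Nat.card_eq_fintype_card] at h2
  rw [← h2]
  congr 1
  simp_rw [h z₀]
  rw [Nat.card_eq_fintype_card, ← Set.toFinset_card]
  congr 1
  ext
  simp

variable {T G H : Type u} [Group T] [Finite T] [Group G] [Group H]

/-- The weight `X ↦ |X| / |T|` if `X S = T`, and `0` otherwise. -/
def orbitWeight (F : Type v) [Field F] (S X : Subgroup T) : F :=
  (Nat.card T : F)⁻¹ * supplementWeight F S X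

/-- For `S` normal in `T`, the linear extension of `A ↦ |(S \ A)^T|`. -/
def fixedOrbits (F : Type v) [Field F] (S : Subgroup T) : FB F T →ₗ[F] F :=
  FB.weight (orbitWeight F S)

omit [Finite T] in
-- Dedekind's modular law: once YS = T, the supplement condition for Y ∩ Z can be tested inside Y.
theorem inf_sup_eq_top_iff (S Y Z : Subgroup T) [S.Normal] :
    Y ⊓ Z ⊔ S = ⊤ ↔ Y ⊔ S = ⊤ ∧ Z.comap Y.subtype ⊔ S.comap Y.subtype = ⊤ := by
  simp only [Subgroup.eq_top_iff', ← SetLike.mem_coe, Subgroup.mul_normal]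
  simp only [Set.mem_mul, SetLike.mem_coe, Subgroup.mem_inf, Subgroup.mem_comap]
  constructor
  · intro h
    refine ⟨fun t => ?_, fun y => ?_⟩
    · obtain ⟨x, hx, s, hs, rfl⟩ := h t
      exact ⟨x, hx.1, s, hs, rfl⟩
    · obtain ⟨x, hx, s, hs, hy⟩ := h y
      have hsY : s ∈ Y := (Subgroup.mul_mem_cancel_left Y hx.1).1 (hy ▸ y.2)
      exact ⟨⟨x, hx.1⟩, hx.2, ⟨s, hsY⟩, hs, Subtype.ext hy⟩
  · rintro ⟨h1, h2⟩ t
    obtain ⟨y, hy, s, hs, rfl⟩ := h1 t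
    obtain ⟨x, hx, s', hs', hy'⟩ := h2 ⟨y, hy⟩
    refine ⟨x, ⟨x.2, hx⟩, s' * s, S.mul_mem hs' hs, ?_⟩
    rw [← mul_assoc]
    exact congrArg (· * s) (congrArg Subtype.val hy')

theorem orbitWeight_inf [CharZero F] (S Y Z : Subgroup T) [S.Normal] :
    orbitWeight F S (Y ⊓ Z) =
      orbitWeight F S Y * orbitWeight F (S.comap Y.subtype) (Z.comap Y.subtype) := by
  have hY : (Nat.card Y : F) ≠ 0 := Nat.cast_ne_zero.2 Nat.card_pos.ne'
  have hc : Nat.card (Z.comap Y.subtype) = Nat.card (Y ⊓ Z : Subgroup T) := by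
    rw [← Subgroup.card_map_of_injective (f := Y.subtype) Y.subtype_injective]
    congr 2
    rw [Subgroup.map_comap_eq, Subgroup.range_subtype]
  simp only [orbitWeight, supplementWeight, inf_sup_eq_top_iff S Y Z, hc]
  by_cases h1 : Y ⊔ S = ⊤ <;> by_cases h2 : Z.comap Y.subtype ⊔ S.comap Y.subtype = ⊤ <;>
    simp only [h1, h2, and_true, and_false, if_true, if_false, mul_zero, zero_mul]
  field_simp

/-- The stabilizer in T of a pair (b, a) is the intersection of those of b and a. Applying
`orbitWeight_inf` with b fixed leaves a form of the same kind, on the stabilizer of b, evaluated at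
y. -/
theorem fixedOrbits_res_prod [CharZero F] {K : Type u} [Group K] (S : Subgroup T) [S.Normal]
    (α : T →* (G × H) × K) (B : FinGSet (G × K)) (y : FBK F K H) :
    fixedOrbits F S (FB.res F α (FBK.prod F K G H (FB.cls F B) y)) =
      ∑ b : B.carrier,
        let Y := (MulAction.stabilizer (G × K) b).comap
          ((MonoidHom.fst _ _).comp ((FBK.diag K G H).comp α))
        orbitWeight F S Y * fixedOrbits F (S.comap Y.subtype)
          (FB.res F (((MonoidHom.snd _ _).comp ((FBK.diag K G H).comp α)).comp Y.subtype) y) := by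
  set β := (FBK.diag K G H).comp α
  let Y (b : B.carrier) := (MulAction.stabilizer (G × K) b).comap ((MonoidHom.fst _ _).comp β)
  have h : (fixedOrbits F S).comp ((FB.res F α).comp (FBK.prod F K G H (FB.cls F B))) =
      ∑ b : B.carrier, orbitWeight F S (Y b) • (fixedOrbits F (S.comap (Y b).subtype)).comp
        (FB.res F (((MonoidHom.snd _ _).comp β).comp (Y b).subtype)) := by
    refine FB.hom_ext F fun A => ?_
    simp only [LinearMap.comp_apply, LinearMap.sum_apply, LinearMap.smul_apply, FBK.prod,
      LinearMap.compr₂_apply, FB.extProd_cls, fixedOrbits, FB.weight_res, FB.weight_cls_extProd,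
      smul_eq_mul]
    simp only [FB.weight_cls, Finset.mul_sum]
    refine Finset.sum_congr rfl fun b _ => Finset.sum_congr rfl fun a _ => ?_
    exact orbitWeight_inf S (Y b) ((MulAction.stabilizer _ a).comap ((MonoidHom.snd _ _).comp β))
  simpa using LinearMap.congr_fun h y

/-- This compares forms for T × G and S × G with forms for T and S; the factor |D ∩ (1 × G)| / |G|
is what averages over G-orbits. -/
theorem orbitWeight_comap_fst [CharZero F] [Finite G] (S : Subgroup T)
    (D : Subgroup (T × G)) :
    orbitWeight F (S.comap (MonoidHom.fst T G)) D = (Nat.card G : F)⁻¹ *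
      (Nat.card (D.comap (MonoidHom.inr T G)) * orbitWeight F S (D.map (MonoidHom.fst T G))) := by
  have h1 : Nat.card (D.comap (MonoidHom.inr T G)) =
      Nat.card (D ⊓ (MonoidHom.fst T G).ker : Subgroup (T × G)) := by
    rw [← Subgroup.card_map_of_injective (f := MonoidHom.inr T G) (Prod.mk_right_injective (1 : T))]
    congr 2
    rw [Subgroup.map_comap_eq, inf_comm]
    ext ⟨t, g⟩
    exact and_congr_right fun _ => ⟨fun ⟨g', hg'⟩ => (congrArg Prod.fst hg').symm,
      fun (ht : t = 1) => ⟨g, Prod.ext ht.symm rfl⟩⟩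
  simp only [orbitWeight, supplementWeight,
    sup_comap_eq_top_iff (MonoidHom.fst T G) Prod.fst_surjective, h1]
  rw [← card_map_mul_card_inf_ker (MonoidHom.fst T G) D, Nat.card_prod]
  split_ifs
  · push_cast
    rw [mul_inv]
    ring
  · simp

/-- The stabilizer of `v` in `T × G` for the action `(t, g) • v = α(t) v g⁻¹`. -/
def bistabilizer (V : FinBiset H G) (α : T →* H) (v : V.carrier) : Subgroup (T × G) where
  carrier := {x | α x.1 • v = MulOpposite.op x.2 • v}
  one_mem' := by simp
  mul_mem' := by
    intro x y hx hy
    simp only [Set.mem_ofPred_eq, Prod.fst_mul, Prod.snd_mul, map_mul, mul_smul,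
      MulOpposite.op_mul] at hx hy ⊢
    rw [hy, smul_comm, hx]
  inv_mem' := by
    intro x hx
    simp only [Set.mem_ofPred_eq, Prod.fst_inv, Prod.snd_inv, map_inv, MulOpposite.op_inv] at hx ⊢
    rw [inv_smul_eq_iff, smul_comm, hx, inv_smul_smul]

/-- Since V ×_G A is the set of G-orbits on V × A, its S-orbits fixed by T are the (S × G)-orbits on
V × A fixed by T × G. The latter are counted through the stabilizers of the points v, as for
products. -/
theorem fixedOrbits_res_bisetMap [CharZero F] [Finite G] (S : Subgroup T) [S.Normal]
    (V : FinBiset H G) (α : T →* H) (y : FB F G) :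
    fixedOrbits F S (FB.res F α (FB.bisetMap F V y)) =
      ∑ v : V.carrier, orbitWeight F (S.comap (MonoidHom.fst T G)) (bistabilizer V α v) *
        fixedOrbits F ((S.comap (MonoidHom.fst T G)).comap (bistabilizer V α v).subtype)
          (FB.res F ((MonoidHom.snd T G).comp (bistabilizer V α v).subtype) y) := by
  have h : (fixedOrbits F S).comp ((FB.res F α).comp (FB.bisetMap F V)) =
      ∑ v : V.carrier, orbitWeight F (S.comap (MonoidHom.fst T G)) (bistabilizer V α v) •
        (fixedOrbits F ((S.comap (MonoidHom.fst T G)).comap (bistabilizer V α v).subtype)).comp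
          (FB.res F ((MonoidHom.snd T G).comp (bistabilizer V α v).subtype)) := by
    refine FB.hom_ext F fun A => ?_
    simp only [LinearMap.comp_apply, LinearMap.sum_apply, LinearMap.smul_apply,
      FB.bisetMap_cls, fixedOrbits, FB.weight_res, FB.weight_cls, smul_eq_mul, Finset.mul_sum]
    let D (z : V.carrier × A.carrier) : Subgroup (T × G) :=
      bistabilizer V α z.1 ⊓ (MulAction.stabilizer G z.2).comap (MonoidHom.snd T G)
    -- `D z` is the stabilizer of z in T × G. It meets 1 × G in the G-stabilizer of z (`hD1`) and
    -- projects onto the T-stabilizer of the class of z (`hD2`).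
    calc _ = ∑ z : V.carrier × A.carrier, orbitWeight F (S.comap (MonoidHom.fst T G)) (D z) := ?_
      _ = _ := by
        rw [Fintype.sum_prod_type]
        refine Finset.sum_congr rfl fun v _ => Finset.sum_congr rfl fun a _ => ?_
        exact orbitWeight_inf _ _ _
    simp_rw [orbitWeight_comap_fst]
    let _ : MulAction G (V.carrier × A.carrier) :=
      { smul := fun g z => (MulOpposite.op g⁻¹ • z.1, g • z.2)
        one_smul := fun z => by
          change (MulOpposite.op (1 : G)⁻¹ • z.1, (1 : G) • z.2) = z
          simp
        mul_smul := fun g h z => by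
          change (MulOpposite.op (g * h)⁻¹ • z.1, (g * h) • z.2) =
            (MulOpposite.op g⁻¹ • MulOpposite.op h⁻¹ • z.1, g • h • z.2)
          simp [mul_smul] }
    have hG : (Nat.card G : F) ≠ 0 := Nat.cast_ne_zero.2 Nat.card_pos.ne'
    have hs (g : G) (z : V.carrier × A.carrier) :
      g • z = (MulOpposite.op g⁻¹ • z.1, g • z.2) := rfl
    have hD1 (z : V.carrier × A.carrier) :
        (D z).comap (MonoidHom.inr T G) = MulAction.stabilizer G z := by
      ext g
      simp only [Subgroup.mem_comap, D, Subgroup.mem_inf, MulAction.mem_stabilizer_iff, hs,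
        Prod.ext_iff, MonoidHom.inr_apply, MonoidHom.coe_snd, MulOpposite.op_inv, inv_smul_eq_iff]
      refine and_congr_left fun _ => ?_
      change α 1 • z.1 = MulOpposite.op g • z.1 ↔ _
      rw [map_one, one_smul]
    have hD2 (z : V.carrier × A.carrier) : (D z).map (MonoidHom.fst T G) =
        (MulAction.stabilizer H (show (V.balancedProd A).carrier from
          Quotient.mk (V.balancedSetoid A) z)).comap α := by
      ext t
      have h1 : t ∈ (MulAction.stabilizer H (show (V.balancedProd A).carrier from
          Quotient.mk (V.balancedSetoid A) z)).comap α ↔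
          ∃ g : G, z = (MulOpposite.op g • α t • z.1, g⁻¹ • z.2) := Quotient.eq
      rw [h1, Subgroup.mem_map]
      constructor
      · rintro ⟨⟨t, g⟩, ⟨h2, h3⟩, rfl⟩
        change α t • z.1 = MulOpposite.op g • z.1 at h2
        change g • z.2 = z.2 at h3
        refine ⟨g⁻¹, Prod.ext ?_ ?_⟩
        · simp [h2]
        · simp [h3]
      · rintro ⟨g, hg⟩
        obtain ⟨h2, h3⟩ := Prod.ext_iff.1 hg
        refine ⟨(t, g⁻¹), ⟨?_, ?_⟩, rfl⟩
        · change α t • z.1 = MulOpposite.op g⁻¹ • z.1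
          rw [MulOpposite.op_inv, eq_inv_smul_iff]
          exact h2.symm
        · exact h3.symm
    have key := sum_card_stabilizer_mul (F := F) (G := G) (Z := V.carrier × A.carrier)
      (Y := (V.balancedProd A).carrier)
      (π := fun z => Quotient.mk (V.balancedSetoid A) z) Quotient.mk_surjective
      (fun z z' => by
        refine eq_comm.trans (Quotient.eq.trans ?_)
        constructor
        · rintro ⟨g, rfl⟩
          exact ⟨g⁻¹, by simp [hs]⟩
        · rintro ⟨g, rfl⟩
          exact ⟨g⁻¹, by simp [hs]⟩) (fun y => orbitWeight F S ((MulAction.stabilizer H y).comap α))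
    simp_rw [hD1, hD2, ← Finset.mul_sum]
    rw [key, inv_mul_cancel_left₀ hG]
  simpa using LinearMap.congr_fun h y

end FixedOrbits

/-! ## Persistence -/

section Op

variable {G H : Type u} [Group G] [Group H] {p : ℕ}

theorem Op_le_ker (f : G →* H) (hH : IsPGroup p H) [Finite G] [hp : Fact p.Prime] :
    Op p G ≤ f.ker := by
  rw [Op, Subgroup.closure_le]
  intro x hx
  obtain ⟨k, hk⟩ := hH (f x)
  have h1 : orderOf (f x) ∣ p ^ k := orderOf_dvd_of_pow_eq_one hk
  have h2 : orderOf (f x) ∣ orderOf x := orderOf_map_dvd f x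
  have h3 : Nat.Coprime (p ^ k) (orderOf x) :=
    Nat.Coprime.pow_left k ((Nat.Prime.coprime_iff_not_dvd hp.out).2 hx)
  exact orderOf_eq_one_iff.1 (Nat.eq_one_of_dvd_coprimes h3 h1 h2)

theorem Op_map_le (f : G →* H) [Finite G] [Finite H] [hp : Fact p.Prime] :
    Op p G ≤ (Op p H).comap f := by
  have h := Op_le_ker ((QuotientGroup.mk' (Op p H)).comp f) (isPGroup_pQuot p H)
  rwa [← MonoidHom.comap_ker, QuotientGroup.ker_mk'] at h

/-- The quotient of H by the image of O^p(G) is a quotient of G / O^p(G), hence a p-group. -/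
theorem Op_le_map (f : G →* H) (hf : Function.Surjective f) [Finite G] [Finite H]
    [hp : Fact p.Prime] : Op p H ≤ (Op p G).map f := by
  have hn : ((Op p G).map f).Normal := (Op_normal p G).map f hf
  have h := Op_le_ker (QuotientGroup.mk' ((Op p G).map f)) (p := p) ?_
  · rwa [QuotientGroup.ker_mk'] at h
  · refine (isPGroup_pQuot p G).of_surjective
      (QuotientGroup.map _ ((Op p G).map f) f (Subgroup.le_comap_map f _)) ?_
    exact QuotientGroup.map_surjective_of_surjective _ _ f
      ((QuotientGroup.mk'_surjective _).comp hf) _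

end Op

theorem graph_eq_range {L K : Type u} [Group L] [Group K] (φ : L →* K) :
    φ.graph = ((MonoidHom.id L).prod φ).range := by
  ext x
  simp [MonoidHom.mem_graph, Prod.ext_iff]

section Persistence

variable {F : Type v} [Field F] [CharZero F] {K : Type u} [Group K] [Finite K] (p : ℕ)
  [hp : Fact p.Prime]

/-- The condition that `S` contains `O^p(T) ∩ Ker θ`. -/
def ContainsOpKer {T K : Type u} [Group T] [Group K] (S : Subgroup T) (θ : T →* K) : Prop :=
  ∀ t ∈ Op p T, θ t = 1 → t ∈ S

theorem ContainsOpKer.of_comp {p : ℕ} [Fact p.Prime] {T T' K : Type u} [Group T] [Group K]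
    [Group T'] [Finite T] [Finite T'] {S : Subgroup T} {θ : T →* K} (h : ContainsOpKer p S θ)
    (f : T' →* T) {θ' : T' →* K} (hθ : ∀ t, θ' t = 1 → θ (f t) = 1) :
    ContainsOpKer p (S.comap f) θ' :=
  fun t ht ht1 => h (f t) (Op_map_le f ht) (hθ t ht1)

variable (F K) in
/-- The common kernel of the forms `A ↦ |(S \ A)^T|`, for the finite groups `T` over `G × K` and
the normal subgroups `S` of `T` containing the intersection of `O^p(T)` with the kernel of
`T → K`. -/
def fixedOrbitsIdeal : GreenIdeal F K (fun _ _ => True) where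
  carrier G _ _ _ :=
    { carrier := {x | ∀ (T : Type u) [Group T] [Finite T] (S : Subgroup T) [S.Normal]
        (α : T →* G × K), ContainsOpKer p S ((MonoidHom.snd G K).comp α) →
        fixedOrbits F S (FB.res F α x) = 0}
      zero_mem' := by
        intro T _ _ S _ α _
        simp
      add_mem' := by
        intro x y hx hy T _ _ S _ α h
        rw [map_add, map_add, hx T S α h, hy T S α h, add_zero]
      smul_mem' := by
        intro c x hx T _ _ S _ α h
        rw [map_smul, map_smul, hx T S α h, smul_zero] }
  bisetMap_mem := by
    intro G H _ _ _ _ _ _ U x hx T _ _ S _ α h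
    rw [FBK.bisetMap, fixedOrbits_res_bisetMap]
    refine Finset.sum_eq_zero fun v _ => mul_eq_zero_of_right _ (hx _ _ _ ?_)
    rw [Subgroup.comap_comap]
    refine h.of_comp ((MonoidHom.fst T (G × K)).comp (bistabilizer (U.shift K) α v).subtype) ?_
    rintro ⟨⟨t, g⟩, ht⟩ (hg : g.2 = 1)
    -- Comparing K-components of the stabilizer equation, the K-images of t and g are conjugate, so
    -- one is trivial when the other is.
    have h1 : (α t).2 * (show U.carrier × K from v).2 = (show U.carrier × K from v).2 * g.2 := congrArg Prod.snd ht
    change (α t).2 = 1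
    simpa [hg] using h1
  prod_mem := by
    intro G H _ _ _ _ _ _ _ x y hy
    suffices hlin : ∀ (T : Type u) [Group T] [Finite T] (S : Subgroup T) [S.Normal]
        (α : T →* (G × H) × K), ContainsOpKer p S ((MonoidHom.snd (G × H) K).comp α) →
        (fixedOrbits F S).comp ((FB.res F α).comp ((FBK.prod F K G H).flip y)) = 0 from
      fun T _ _ S _ α h => LinearMap.congr_fun (hlin T S α h) x
    intro T _ _ S _ α h
    refine FB.hom_ext F fun B => ?_
    change fixedOrbits F S (FB.res F α (FBK.prod F K G H (FB.cls F B) y)) = 0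
    rw [fixedOrbits_res_prod]
    refine Finset.sum_eq_zero fun b _ => mul_eq_zero_of_right _ (hy _ _ _ ?_)
    exact h.of_comp _ fun t ht => ht

theorem fixedOrbits_bot_res_subtype {G : Type u} [Group G] [Finite G] (H : Subgroup G)
    (x : FB F G) : fixedOrbits F (⊥ : Subgroup H) (FB.res F H.subtype x) = FB.mark F H x := by
  rw [fixedOrbits, FB.weight_res, FB.mark]
  congr 2
  funext Y
  have h : Y.comap H.subtype ⊔ ⊥ = ⊤ ↔ H ≤ Y := by
    rw [sup_bot_eq]
    exact Subgroup.subgroupOf_eq_top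
  simp only [orbitWeight, supplementWeight, h]
  split_ifs with h1
  · rw [h.2 h1 |> (sup_bot_eq _).symm.trans, Subgroup.card_top]
    exact inv_mul_cancel₀ (Nat.cast_ne_zero.2 Nat.card_pos.ne')
  · simp

/-- For H ≤ P × K, O^p(H) dies in the p-group P, so it meets the kernel of H → K trivially. Hence S
= ⊥ is allowed, and the corresponding form is the mark at H. -/
theorem fixedOrbitsIdeal_eq_bot {P : Type u} [Group P] [Finite P] (hP : IsPGroup p P) :
    (fixedOrbitsIdeal F K p).carrier P trivial = ⊥ := by
  rw [eq_bot_iff]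
  intro x hx
  rw [Submodule.mem_bot]
  refine FB.eq_of_mark_eq fun H => ?_
  rw [map_zero, ← fixedOrbits_bot_res_subtype]
  refine hx H ⊥ H.subtype fun t ht h1 => ?_
  have h2 : (MonoidHom.fst P K).comp H.subtype t = 1 := Op_le_ker _ hP ht
  exact Subtype.ext (Prod.ext h2 h1)

/-- Along a conjugate embedding j of the graph, the form on the idempotent becomes a Möbius
coefficient over the subgroups of L. Its weight is proportional to the supplement weight of N =
j⁻¹(α(S)), so it is a multiple of m_{L,N}. -/
theorem exists_mConst_ne_zero {L : Type u} [Group L] [Finite L] (φ : L →* K) {T : Type u}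
    [Group T] [Finite T] (S : Subgroup T) [S.Normal] (α : T →* L × K)
    (h : ContainsOpKer p S ((MonoidHom.snd L K).comp α))
    (hne : fixedOrbits F S (FB.res F α (idem F φ.graph)) ≠ 0) :
    ∃ (N : Subgroup L) (_ : N.Normal), Op p L ⊓ φ.ker ≤ N ∧ mConst L N ≠ 0 := by
  let j₀ : L →* L × K := (MonoidHom.id L).prod φ
  have hj₀ : φ.graph = j₀.range := graph_eq_range φ
  rw [fixedOrbits, FB.weight_res, FB.weight_idem] at hne
  obtain ⟨g, -, hg⟩ := Finset.exists_ne_zero_of_sum_ne_zero (right_ne_zero_of_mul hne)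
  let j : L →* L × K := (MulAut.conj g).toMonoidHom.comp j₀
  have hj₀' : Function.Injective j₀ := fun x y h => congrArg Prod.fst h
  have hj : Function.Injective j := (MulAut.conj g).injective.comp hj₀'
  rw [hj₀, moebiusCoeff_range j₀ hj₀'] at hg
  simp_rw [Subgroup.map_map] at hg
  change moebiusCoeff (fun A : Subgroup L => orbitWeight F S ((A.map j).comap α)) ⊤ ≠ 0 at hg
  -- The weight at A depends only on A ∩ j⁻¹(im α), so Weisner's theorem forces j(L) into the image
  -- of α.
  have hrange : ∀ l, j l ∈ α.range := by
    by_contra hcon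
    refine hg (moebiusCoeff_eq_zero (A := α.range.comap j) (fun X => ?_) fun h => hcon fun l =>
      h (Subgroup.mem_top l))
    congr 1
    have h1 : α.range.comap α = ⊤ := by
      ext t
      simp
    rw [map_inf_comap, Subgroup.comap_inf, h1, inf_top_eq]
  have hS : j.range.comap α ⊔ S = ⊤ := by
    obtain ⟨A, -, hA⟩ := Finset.exists_ne_zero_of_sum_ne_zero hg
    have hA2 : (A.map j).comap α ⊔ S = ⊤ := by
      by_contra hcon
      exact hA (by simp [orbitWeight, supplementWeight, hcon])
    rw [eq_top_iff, ← hA2]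
    exact sup_le_sup_right (Subgroup.comap_mono (Subgroup.map_le_range j A)) S
  let N : Subgroup L := (S.map α).comap j
  have hN : N.Normal := by
    refine ⟨fun n hn l => ?_⟩
    obtain ⟨s, hs, hs2⟩ := hn
    obtain ⟨t, ht⟩ := hrange l
    exact ⟨t * s * t⁻¹, Subgroup.Normal.conj_mem inferInstance s hs t, by simp [hs2, ht]⟩
  have hsup (A : Subgroup L) : (A.map j).comap α ⊔ S = ⊤ ↔ A ⊔ N = ⊤ := by
    simp only [Subgroup.eq_top_iff', ← SetLike.mem_coe, Subgroup.mul_normal] at hS ⊢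
    constructor
    · intro h1 l
      obtain ⟨t, ht⟩ := hrange l
      obtain ⟨t', ⟨a, ha, ha2⟩, s, hs, rfl⟩ := h1 t
      exact ⟨a, ha, a⁻¹ * l, ⟨s, hs, by simp [← ht, ha2]⟩, by simp⟩
    · intro h1 t
      obtain ⟨t', ⟨l, hl⟩, s, hs, rfl⟩ := hS t
      obtain ⟨a, ha, n, ⟨s', hs', hn⟩, rfl⟩ := h1 l
      refine ⟨t' * s'⁻¹, ⟨a, ha, ?_⟩, s' * s, S.mul_mem hs' hs, by simp [mul_assoc]⟩
      rw [map_mul, map_inv, hn, ← hl]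
      simp
  have hcard (A : Subgroup L) :
      Nat.card ((A.map j).comap α) = Nat.card A * Nat.card α.ker := by
    rw [← card_map_mul_card_inf_ker α, inf_eq_right.2 (Subgroup.ker_le_comap α _),
      Subgroup.map_comap_eq_self, Subgroup.card_map_of_injective hj]
    rintro _ ⟨a, -, rfl⟩
    exact hrange a
  have hweight (A : Subgroup L) : orbitWeight F S ((A.map j).comap α) =
      ((Nat.card T : F)⁻¹ * Nat.card α.ker) * supplementWeight F N A := by
    simp only [orbitWeight, supplementWeight, hsup, hcard]
    split_ifs
    · push_cast
      ring
    · simp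
  simp_rw [hweight, moebiusCoeff_const_mul] at hg
  refine ⟨N, hN, ?_, (mConst_ne_zero_iff F N).2 (right_ne_zero_of_mul hg)⟩
  rintro l ⟨hl, hl1⟩
  let q : j.range.comap α →* L :=
    (MonoidHom.ofInjective hj).symm.toMonoidHom.comp (α.subgroupComap j.range)
  have hq (t : j.range.comap α) : j (q t) = α t :=
    congrArg Subtype.val ((MonoidHom.ofInjective hj).apply_symm_apply (α.subgroupComap j.range t))
  have hqs : Function.Surjective q := fun l => by
    obtain ⟨t, ht⟩ := hrange l
    exact ⟨⟨t, l, ht.symm⟩, hj ((hq _).trans ht)⟩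
  -- Lift l to t in O^p of the preimage of j(L). The K-component of α(t) is conjugate to φ(l) = 1,
  -- so t lies in S and j(l) = α(t) lies in α(S).
  obtain ⟨t, ht, rfl⟩ := Op_le_map q hqs hl
  refine ⟨t, h t (Op_map_le (Subgroup.subtype _) ht) ?_, (hq t).symm⟩
  change (α t).2 = 1
  rw [← hq t]
  change g.2 * φ (q t) * g.2⁻¹ = 1
  rw [MonoidHom.mem_ker.1 hl1]
  simp

/-- Multiplicativity along L → L / R makes m_{L,R} a factor of m_{L,N}. -/
theorem mConst_ne_zero_of_le {L : Type u} [Group L] [Finite L] {R N : Subgroup L} [R.Normal]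
    [N.Normal] (h : R ≤ N) (hN : mConst L N ≠ 0) : mConst L R ≠ 0 := by
  have : (N.map (QuotientGroup.mk' R)).Normal :=
    Subgroup.Normal.map inferInstance _ (QuotientGroup.mk'_surjective R)
  have h1 := mConst_comap (QuotientGroup.mk' R) (QuotientGroup.mk'_surjective R)
    (N.map (QuotientGroup.mk' R))
  have h2 : (N.map (QuotientGroup.mk' R)).comap (QuotientGroup.mk' R) = N :=
    Subgroup.comap_map_eq_self (by rwa [QuotientGroup.ker_mk'])
  simp only [h2, QuotientGroup.ker_mk'] at h1
  exact left_ne_zero_of_mul (h1 ▸ hN)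

theorem mConst_ne_zero_of_isPersistent {L : GrpOver K} (h : IsPersistent F p L) :
    mConst L.carrier (Op p L.carrier ⊓ L.hom.ker) ≠ 0 := by
  obtain ⟨P, _, _, hP, hne⟩ := h
  have h1 : ¬ idem F L.hom.graph ∈ (fixedOrbitsIdeal F K p).carrier L.carrier trivial := by
    intro h2
    refine hne (le_bot_iff.1 ?_)
    rw [← fixedOrbitsIdeal_eq_bot (F := F) (K := K) p hP]
    exact (GreenIdeal.span_le trivial _ _).2 h2 P trivial
  have h3 : ∃ (T : Type u) (_ : Group T) (_ : Finite T) (S : Subgroup T) (_ : S.Normal)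
      (α : T →* L.carrier × K), ContainsOpKer p S ((MonoidHom.snd L.carrier K).comp α) ∧
      fixedOrbits F S (FB.res F α (idem F L.hom.graph)) ≠ 0 := by
    by_contra hcon
    push Not at hcon
    exact h1 fun T hT hT' S hS α => hcon T hT hT' S hS α
  obtain ⟨T, _, _, S, _, α, hS, hne⟩ := h3
  obtain ⟨N, _, hN, hm⟩ := exists_mConst_ne_zero p L.hom S α hS hne
  exact mConst_ne_zero_of_le hN hm

end Persistence

/-! ## Surjective morphisms of groups over `K` -/

section Surjective

variable {K : Type u} [Group K]

/-- Conjugation by k⁻¹ in the K-component absorbs the inner automorphism of the morphism. General a,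
b and f let one statement serve both graphs and p-graphs. -/
theorem range_prod_map_shiftHom {M L G H : Type u} [Group M] [Group L] [Group G] [Group H]
    {s : M →* L} (hs : Function.Surjective s) {ψ : M →* K} {φ : L →* K} {k : K}
    (hk : (MulAut.conj k).toMonoidHom.comp ψ = φ.comp s) {a : M →* G} {b : L →* H} {f : G →* H}
    (hf : f.comp a = b.comp s) :
    (b.prod φ).range.map (MulAut.conj ((1, k⁻¹) : H × K)).toMonoidHom =
      (a.prod ψ).range.map (shiftHom K f) := by
  have h1 : (b.prod φ).range = ((b.prod φ).comp s).range := by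
    rw [MonoidHom.range_comp, MonoidHom.range_eq_top.2 hs, MonoidHom.range_eq_map]
  rw [h1, ← MonoidHom.range_comp, ← MonoidHom.range_comp]
  congr 1
  ext m
  · have := DFunLike.congr_fun hf m
    simpa using this.symm
  · have h2 : k * ψ m * k⁻¹ = φ (s m) := DFunLike.congr_fun hk m
    simp [← h2, mul_assoc]

theorem mConst_congr {L : Type u} [Group L] [Finite L] {N N' : Subgroup L} [N.Normal]
    [N'.Normal] (h : N = N') : mConst L N = mConst L N' := by
  subst h
  rfl

theorem hom_eq_one_iff_of_morphism {M L : GrpOver K} (s : M ⟶ L) (m : M.carrier) :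
    L.hom (s.toMonoidHom m) = 1 ↔ M.hom m = 1 := by
  obtain ⟨k, hk⟩ := s.exists_inner
  have h : k * M.hom m * k⁻¹ = L.hom (s.toMonoidHom m) := DFunLike.congr_fun hk m
  rw [← h, conj_eq_one_iff]

variable [Finite K] (F : Type v) [Field F] [CharZero F] {M L : GrpOver K} (s : M ⟶ L)
  (hs : Function.Surjective s.toMonoidHom)
include hs

theorem eIdeal_le : eIdeal F M ≤ eIdeal F L := by
  obtain ⟨k, hk⟩ := s.exists_inner
  refine GreenIdeal.span_idem_le_of_map_eq trivial trivial trivial s.toMonoidHom ⟨(1, k⁻¹), ?_⟩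
  rw [graph_eq_range, graph_eq_range]
  exact range_prod_map_shiftHom hs hk rfl

theorem eIdeal_ge (hm : mConst M.carrier s.toMonoidHom.ker ≠ 0) : eIdeal F L ≤ eIdeal F M := by
  obtain ⟨k, hk⟩ := s.exists_inner
  rw [eIdeal, eIdeal, graph_eq_range M.hom]
  refine GreenIdeal.span_idem_le_of_mConst_ne_zero trivial trivial trivial s.toMonoidHom _
    (fun x y h => congrArg Prod.fst h) ⟨(1, k⁻¹), ?_⟩ ?_
  · rw [graph_eq_range]
    exact range_prod_map_shiftHom hs hk rfl
  · rwa [mConst_congr (N' := s.toMonoidHom.ker)]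
    ext m
    rw [MonoidHom.mem_ker, MonoidHom.mem_ker]
    refine ⟨fun h => congrArg Prod.fst h, fun h => Prod.ext h ?_⟩
    exact (hom_eq_one_iff_of_morphism s m).1 (by rw [h, map_one])

/-! ### The ideals on p-groups -/

variable (p : ℕ) [hp : Fact p.Prime]

omit hs in
/-- The homomorphism `M^{[p]} → L^{[p]}` induced by a homomorphism `M → L`. -/
def pQuotMap : pQuot p M.carrier →* pQuot p L.carrier :=
  QuotientGroup.map _ _ s.toMonoidHom (Op_map_le s.toMonoidHom)

omit hs hp [Finite K] in
theorem isPGroup_prod {A B : Type*} [Group A] [Group B] (hA : IsPGroup p A) (hB : IsPGroup p B) :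
    IsPGroup p (A × B) := by
  rintro ⟨a, b⟩
  obtain ⟨m, hm⟩ := hA a
  obtain ⟨n, hn⟩ := hB b
  refine ⟨m + n, Prod.ext ?_ ?_⟩
  · rw [Prod.pow_fst, pow_add, pow_mul, hm, one_pow, Prod.fst_one]
  · rw [Prod.pow_snd, pow_add, mul_comm, pow_mul, hn, one_pow, Prod.snd_one]

omit [Finite K] in
theorem pGraph_map : ∃ g, (pGraph p L).map (MulAut.conj g).toMonoidHom =
    (pGraph p M).map (shiftHom K (pQuotMap s p)) := by
  obtain ⟨k, hk⟩ := s.exists_inner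
  exact ⟨(1, k⁻¹), range_prod_map_shiftHom hs hk rfl⟩

theorem eIdealP_le : eIdealP F p M ≤ eIdealP F p L :=
  GreenIdeal.span_idem_le_of_map_eq _ _
    (isPGroup_prod p (isPGroup_pQuot p _) (isPGroup_pQuot p _)) (pQuotMap s p) (pGraph_map s hs p)

omit hp in
theorem isPersistent_of_surjective (h : IsPersistent F p M) : IsPersistent F p L := by
  obtain ⟨P, _, _, hP, hne⟩ := h
  exact ⟨P, _, _, hP, ne_bot_of_le_ne_bot hne (eIdeal_le F s hs P trivial)⟩

theorem eIdealP_ge (hL : IsPersistent F p L) (hm : mConst M.carrier s.toMonoidHom.ker ≠ 0) :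
    eIdealP F p L ≤ eIdealP F p M := by
  have hrange : (pGraph p M).subtype.range = pGraph p M := Subgroup.range_subtype _
  have h := GreenIdeal.span_idem_le_of_mConst_ne_zero (F := F) (isPGroup_pQuot p M.carrier)
    (isPGroup_pQuot p L.carrier) (isPGroup_prod p (isPGroup_pQuot p _) (isPGroup_pQuot p _))
    (pQuotMap s p) (pGraph p M).subtype Subtype.val_injective (Y := pGraph p L)
    (by rw [hrange]; exact pGraph_map s hs p)
  rw [hrange] at h
  refine h ?_
  let π : M.carrier →* pGraph p M :=
    ((QuotientGroup.mk' (Op p M.carrier)).prod M.hom).rangeRestrict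
  have hπ : Function.Surjective π := MonoidHom.rangeRestrict_surjective _
  -- The same constant of M is factored in two ways, through the p-graph of M and through L. The
  -- second factorization is nonzero by hypothesis and persistence, hence so is the factor on the
  -- p-graph.
  have h1 := mConst_comap π hπ
    ((shiftHom K (pQuotMap s p)).comp (pGraph p M).subtype).ker
  have h2 := mConst_comap s.toMonoidHom hs (Op p L.carrier ⊓ L.hom.ker)
  have h3 : (((shiftHom K (pQuotMap s p)).comp (pGraph p M).subtype).ker).comap π =
      (Op p L.carrier ⊓ L.hom.ker).comap s.toMonoidHom := by
    ext m
    rw [Subgroup.mem_comap, Subgroup.mem_comap, Subgroup.mem_inf, MonoidHom.mem_ker,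
      MonoidHom.mem_ker, hom_eq_one_iff_of_morphism, ← QuotientGroup.eq_one_iff]
    exact Prod.ext_iff
  rw [mConst_congr h3, h2] at h1
  exact right_ne_zero_of_mul (h1 ▸ mul_ne_zero hm (mConst_ne_zero_of_isPersistent p hL))

end Surjective

end

end RelativeBurnside

open RelativeBurnside
theorem mainTheorem12 (F : Type v) [Field F] [CharZero F] (K : Type u) [Group K] [Finite K]
    (M L : GrpOver K) (s : M ⟶ L) (hs : Function.Surjective s.toMonoidHom) :
    (mConst M.carrier s.toMonoidHom.ker ≠ 0 → eIdeal F M = eIdeal F L) ∧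
    (∀ (p : ℕ) [Fact p.Prime], IsPersistent F p M →
      IsPersistent F p L ∧ eIdealP F p M ≤ eIdealP F p L ∧
      (mConst M.carrier s.toMonoidHom.ker ≠ 0 → eIdealP F p M = eIdealP F p L)) := by
  refine ⟨fun hm => le_antisymm (eIdeal_le F s hs) (eIdeal_ge F s hs hm), fun p _ hM => ?_⟩
  have hL := isPersistent_of_surjective F s hs p hM
  exact ⟨hL, eIdealP_le F s hs p,
    fun hm => le_antisymm (eIdealP_le F s hs p) (eIdealP_ge F s hs p hL hm)⟩
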